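/- Consider 3-CNF formulas over the variables $x_1,\dots,x_n$. A clause is a disjunction of three literals over three distinct variables, so there are $M=8\binom n3$ possible clauses. For $p\in[0,1]$, let $\mathcal P^{\rm sat}_{n,p}$ be the distribution of the random satisfiable formula $F^*$ generated as follows: order all $M$ clauses by a uniformly random permutation, start from the empty formula, scan the clauses in this order, and for each clause toss an independent coin with success probability $p$; the clause is included if its coin toss succeeds and the formula remains satisfiable after its addition. The Majority Vote assignment $\mathrm{MAJ}$ over a formula $F$ sets a variable $x$ to TRUE if the number of clauses of $F$ that contain the literal $x$ is strictly larger than the number of clauses of $F$ that contain the literal $\bar x$, and to FALSE otherwise. **Proposition.** There are absolute constants $c>0$ and $d>0$ such that the following holds. Let $p=p(n)\in[0,1]$ satisfy $n^2p\ge d$ for all sufficiently large $n$, put $m=pM$, and let $F^*$ be distributed according to $\mathcal P^{\rm sat}_{n,p}$. Then with probability $1-o(m^{-1/2})$, as $n\to\infty$, every satisfying assignment of $F^*$ differs from the assignment $\mathrm{MAJ}$ over $F^*$ on at most $e^{-c\,n^2p}\,n$ variables. -/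

import Mathlib

open scoped ENNReal

namespace RandomSat

/-- A literal over the variables `x_0, …, x_{n-1}`: `(x, true)` is the positive literal `x`,
`(x, false)` is the negated literal. -/
abbrev Literal (n : ℕ) := Fin n × Bool

/-- A 3-clause: a set of three literals over three distinct variables. There are
`8 * n.choose 3` of them. -/
abbrev Clause (n : ℕ) :=
  {C : Finset (Literal n) // C.card = 3 ∧ (C.image Prod.fst).card = 3}

/-- A 3-CNF formula, as a set of clauses. -/
abbrev Formula (n : ℕ) := Finset (Clause n)

/-- A truth assignment. -/
abbrev Assignment (n : ℕ) := Fin n → Bool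

/-- The assignment `ψ` satisfies `F`: every clause of `F` contains a literal that is true
under `ψ`. -/
def Satisfies {n : ℕ} (ψ : Assignment n) (F : Formula n) : Prop :=
  ∀ C ∈ F, ∃ l ∈ C.1, ψ l.1 = l.2

/-- The formula `F` has a satisfying assignment. -/
def Satisfiable {n : ℕ} (F : Formula n) : Prop :=
  ∃ ψ : Assignment n, Satisfies ψ F

/-- The orderings (permutations) of all 3-clauses over `n` variables. -/
abbrev Ordering (n : ℕ) := Fin (Fintype.card (Clause n)) ≃ Clause n

instance (n : ℕ) : Nonempty (Ordering n) := ⟨(Fintype.equivFin (Clause n)).symm⟩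

open Classical in
/-- Scan the clauses in the order `σ`, starting from the empty formula, and include the current
clause if its coin toss was successful and the formula stays satisfiable. -/
noncomputable def process {n : ℕ} (σ : Ordering n) (coin : Clause n → Bool) : Formula n :=
  (List.ofFn σ).foldl
    (fun F C => if coin C = true ∧ Satisfiable (insert C F) then insert C F else F) ∅

/-- Independent coin tosses, one for each clause, each successful with probability `p`. -/
noncomputable def coins (n : ℕ) (p : unitInterval) : PMF (Clause n → Bool) :=
  PMF.ofFintype
    (fun coin => ∏ C, if coin C = true then ENNReal.ofReal p else ENNReal.ofReal (1 - p))
    (by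
      have h := Fintype.prod_sum (R := ℝ≥0∞) (ι := Clause n) (κ := fun _ => Bool)
        (fun _ b => if b = true then ENNReal.ofReal p else ENNReal.ofReal (1 - p))
      rw [← h]
      apply Finset.prod_eq_one
      intro C _
      simp only [Fintype.sum_bool, if_true, Bool.false_eq_true, if_false]
      rw [← ENNReal.ofReal_add p.2.1 (by linarith [p.2.2])]
      simp)

/-- The distribution `P^sat_{n,p}` on satisfiable 3-CNF formulas: the outcome of the process for a
uniformly random ordering of the clauses and independent `p`-coins. -/
noncomputable def Psat (n : ℕ) (p : unitInterval) : PMF (Formula n) :=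
  (PMF.uniformOfFintype (Ordering n)).bind fun σ => (coins n p).map (process σ)

/-- The set of clauses of `F` in which the literal `l` appears. -/
def occurrences {n : ℕ} (F : Formula n) (l : Literal n) : Finset (Clause n) :=
  F.filter fun C => l ∈ C.1

/-- The Majority Vote assignment over `F`: `x` is set to true iff `x` appears positively in more
clauses than negatively. -/
def maj {n : ℕ} (F : Formula n) : Assignment n := fun x =>
  decide ((occurrences F (x, false)).card < (occurrences F (x, true)).card)

/-- Every satisfying assignment of `F` differs from the Majority Vote over `F` on at most `r`
variables. -/
def MajClose {n : ℕ} (F : Formula n) (r : ℝ) : Prop :=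
  ∀ ψ : Assignment n, Satisfies ψ F → (hammingDist ψ (maj F) : ℝ) ≤ r

/-- The expected number `m = p * M` of successful coin tosses, `M = 8 * n.choose 3` being the
number of all 3-clauses. -/
noncomputable def expectedTosses (n : ℕ) (p : unitInterval) : ℝ :=
  p * (8 * n.choose 3 : ℕ)

/-- `whp`, for formulas `F` drawn from `P^sat_{n,p(n)}`: the property `A n` holds with probability
`1 - o(m^{-1/2})`, where `m = p(n) * M`. -/
def Whp (p : ℕ → unitInterval) (A : (n : ℕ) → Formula n → Prop) : Prop :=
  (fun n => ((Psat n (p n)).toOuterMeasure {F | ¬ A n F}).toReal)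
    =o[Filter.atTop] fun n => (Real.sqrt (expectedTosses n (p n)))⁻¹

end RandomSat

/-! Put λ = n²p. Acceptance of a clause depends on the whole history, so the process is replaced by
three independent rounds. A `p`-coin is the disjunction of coins with parameters q, q, q₃, where q =
p/10⁴ and q₃ ≥ p/2. Given which clauses succeed, their order is uniform, and a clause scanned once
is settled for good; hence F* has the law of a formula built in three full scans of the same
ordering (`toReal_Psat_le`). The order within a scan is then harmless, because a selected clause
that is true under some assignment satisfying the current formula cannot have been rejected
(`mem_scan_of_satisfies`).

Round one leaves fewer than n/20 variables unfrozen, that is, not determined by the formula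
(`bernProb_card_unfrozen_le`). The set where two satisfying assignments differ can neither be large
nor be supported by a selected clause, and a union bound over 4ⁿ configurations suffices.

Round two brings the number of unfrozen variables down to e^(-y)n/4 with y = λ/10⁶: any selected
clause on x and two frozen variables with false literals freezes x, by being accepted or by being
rejected (`bernProb_subset_unfrozen_le`).

Round three creates the bias. For a frozen x, every selected clause containing the true literal of x
enters, whereas among those containing the false literal at least n²/4 potential clauses are barred,
being falsified by frozen variables. This drift beats the clauses at x from the two sparse early
rounds, except at few x (`bernProb_subset_contested_le`, `maj_scan_eq`).

Each exceptional set of variables contains a given X with probability at most exp(-4y|X|), which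
makes it small (`bernProb_many_fail_le`). The total failure probability is O(1/(nλ)) = O(1/m), hence
o(m^(-1/2)). -/

namespace RandomSat

/-! ### Independent coin tosses: union bound, Chernoff bound. -/

section Bernoulli

variable {ι : Type*} [Fintype ι]

/-- The probability of the outcome `b` of independent coin tosses with success probability `q`. -/
noncomputable def bernWeight (q : ℝ) (b : ι → Bool) : ℝ :=
  ∏ i, if b i = true then q else 1 - q

theorem bernWeight_nonneg {q : ℝ} (h0 : 0 ≤ q) (h1 : q ≤ 1) (b : ι → Bool) :
    0 ≤ bernWeight q b := by
  apply Finset.prod_nonneg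
  intro i _
  split_ifs <;> linarith

variable [DecidableEq ι]

open Classical in
/-- The probability of the event `A` under independent coin tosses with success
probability `q`. -/
noncomputable def bernProb (q : ℝ) (A : (ι → Bool) → Prop) : ℝ :=
  ∑ b, bernWeight q b * (if A b then 1 else 0)

theorem sum_bernWeight_mul_prod (q : ℝ) (g : ι → Bool → ℝ) :
    ∑ b : ι → Bool, bernWeight q b * ∏ i, g i (b i)
      = ∏ i, (q * g i true + (1 - q) * g i false) := by
  have h := Fintype.prod_sum (R := ℝ) (ι := ι) (κ := fun _ => Bool)
    (fun i b => (if b = true then q else 1 - q) * g i b)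
  simp only [Fintype.sum_bool, if_true, Bool.false_eq_true, if_false] at h
  rw [h]
  refine Finset.sum_congr rfl fun b _ => ?_
  rw [bernWeight, ← Finset.prod_mul_distrib]

theorem sum_bernWeight (q : ℝ) : ∑ b : ι → Bool, bernWeight q b = 1 := by
  have h := sum_bernWeight_mul_prod (ι := ι) q fun _ _ => 1
  simpa using h

theorem bernProb_le_of_le {q : ℝ} (h0 : 0 ≤ q) (h1 : q ≤ 1) {A : (ι → Bool) → Prop}
    {f : (ι → Bool) → ℝ} (hf : ∀ b, 0 ≤ f b) (hA : ∀ b, A b → 1 ≤ f b) :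
    bernProb q A ≤ ∑ b, bernWeight q b * f b := by
  refine Finset.sum_le_sum fun b _ =>
    mul_le_mul_of_nonneg_left ?_ (bernWeight_nonneg h0 h1 b)
  split_ifs with h
  exacts [hA b h, hf b]

theorem bernProb_mono {q : ℝ} (h0 : 0 ≤ q) (h1 : q ≤ 1) {A B : (ι → Bool) → Prop}
    (h : ∀ b, A b → B b) : bernProb q A ≤ bernProb q B := by
  classical
  refine (bernProb_le_of_le h0 h1 (f := fun b => if B b then 1 else 0) ?_ ?_).trans_eq ?_
  · intro b
    split_ifs <;> simp
  · intro b hb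
    simp [h b hb]
  · simp [bernProb]

theorem bernProb_exists_le {q : ℝ} (h0 : 0 ≤ q) (h1 : q ≤ 1) {κ : Type*} (J : Finset κ)
    (A : κ → (ι → Bool) → Prop) :
    bernProb q (fun b => ∃ j ∈ J, A j b) ≤ ∑ j ∈ J, bernProb q (A j) := by
  classical
  refine (bernProb_le_of_le h0 h1
    (f := fun b => ∑ j ∈ J, if A j b then (1 : ℝ) else 0) ?_ ?_).trans_eq ?_
  · intro b
    exact Finset.sum_nonneg fun j _ => by split_ifs <;> simp
  · rintro b ⟨j, hj, hb⟩
    calc (1 : ℝ) = if A j b then (1 : ℝ) else 0 := by simp [hb]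
      _ ≤ _ := Finset.single_le_sum (f := fun j => if A j b then (1 : ℝ) else 0)
        (fun j _ => by split_ifs <;> simp) hj
  · simp only [bernProb, Finset.mul_sum]
    rw [Finset.sum_comm]

theorem bernProb_or_le {q : ℝ} (h0 : 0 ≤ q) (h1 : q ≤ 1) (A B : (ι → Bool) → Prop) :
    bernProb q (fun b => A b ∨ B b) ≤ bernProb q A + bernProb q B := by
  refine (bernProb_mono h0 h1 (B := fun b => ∃ j ∈ (Finset.univ : Finset Bool),
    (fun j : Bool => if j = true then A else B) j b) ?_).trans
    ((bernProb_exists_le h0 h1 _ _).trans_eq ?_)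
  · rintro b (h | h)
    · exact ⟨true, by simp, by simpa using h⟩
    · exact ⟨false, by simp, by simpa using h⟩
  · simp

/-- An average is at most the probability of an exceptional event plus a bound that holds off
this event. -/
theorem sum_bernWeight_mul_le {q : ℝ} (h0 : 0 ≤ q) (h1 : q ≤ 1) {A : (ι → Bool) → Prop}
    {f : (ι → Bool) → ℝ} {δ : ℝ} (hδ : 0 ≤ δ) (hf : ∀ b, f b ≤ 1) (hA : ∀ b, ¬ A b → f b ≤ δ) :
    ∑ b, bernWeight q b * f b ≤ bernProb q A + δ := by
  classical
  calc ∑ b, bernWeight q b * f b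
      ≤ ∑ b, bernWeight q b * ((if A b then 1 else 0) + δ) := by
        refine Finset.sum_le_sum fun b _ =>
          mul_le_mul_of_nonneg_left ?_ (bernWeight_nonneg h0 h1 b)
        by_cases h : A b
        · rw [if_pos h]; linarith [hf b]
        · rw [if_neg h]; linarith [hA b h]
    _ = bernProb q A + δ := by
        simp only [mul_add, Finset.sum_add_distrib, ← Finset.sum_mul, sum_bernWeight, one_mul]
        simp [bernProb]

theorem bernProb_le_one {q : ℝ} (h0 : 0 ≤ q) (h1 : q ≤ 1) (A : (ι → Bool) → Prop) :
    bernProb q A ≤ 1 := by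
  refine (bernProb_le_of_le h0 h1 (f := fun _ => 1) (by simp) (by simp)).trans_eq ?_
  simp [sum_bernWeight]

/-- Chernoff's bound for a weighted number of successes. -/
theorem bernProb_chernoff {q : ℝ} (h0 : 0 ≤ q) (h1 : q ≤ 1) (w : ι → ℝ) (r : ℝ) :
    bernProb q (fun b => r ≤ ∑ i, if b i = true then w i else 0)
      ≤ Real.exp (q * ∑ i, (Real.exp (w i) - 1) - r) := by
  refine (bernProb_le_of_le h0 h1
    (f := fun b => Real.exp (-r) * ∏ i, if b i = true then Real.exp (w i) else 1) ?_ ?_).trans ?_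
  · intro b
    exact mul_nonneg (Real.exp_pos _).le
      (Finset.prod_nonneg fun i _ => by split_ifs <;> positivity)
  · intro b hb
    have : ∏ i, (if b i = true then Real.exp (w i) else 1)
        = Real.exp (∑ i, if b i = true then w i else 0) := by
      rw [Real.exp_sum]
      refine Finset.prod_congr rfl fun i _ => ?_
      split_ifs <;> simp
    rw [this, ← Real.exp_add]
    exact Real.one_le_exp (by linarith)
  · have h := sum_bernWeight_mul_prod (ι := ι) q fun i b =>
      if b = true then Real.exp (w i) else 1
    simp only [mul_left_comm _ (Real.exp (-r)), ← Finset.mul_sum]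
    rw [h, sub_eq_neg_add _ r, Real.exp_add, Finset.mul_sum, Real.exp_sum]
    refine mul_le_mul_of_nonneg_left (Finset.prod_le_prod ?_ ?_) (Real.exp_pos _).le
    · intro i _
      have := Real.exp_pos (w i)
      simp only [if_true, Bool.false_eq_true, if_false]
      nlinarith
    · intro i _
      have := Real.add_one_le_exp (q * (Real.exp (w i) - 1))
      simp only [if_true, Bool.false_eq_true, if_false]
      linarith

/-- The probability that no element of `T` is chosen. -/
theorem bernProb_forall_false_le {q : ℝ} (h0 : 0 ≤ q) (h1 : q ≤ 1) (T : Finset ι) :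
    bernProb q (fun b => ∀ i ∈ T, b i = false) ≤ Real.exp (-(q * T.card)) := by
  refine (bernProb_le_of_le h0 h1
    (f := fun b => ∏ i, if i ∈ T ∧ b i = true then 0 else 1) ?_ ?_).trans ?_
  · intro b
    exact Finset.prod_nonneg fun i _ => by split_ifs <;> simp
  · intro b hb
    rw [Finset.prod_eq_one]
    intro i _
    rw [if_neg]
    rintro ⟨hi, hbi⟩
    simp [hb i hi] at hbi
  · have h := sum_bernWeight_mul_prod (ι := ι) q fun i b =>
      if i ∈ T ∧ b = true then 0 else 1
    rw [h]
    have : Real.exp (-(q * T.card)) = ∏ i, if i ∈ T then Real.exp (-q) else 1 := by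
      rw [Finset.prod_ite_mem, Finset.univ_inter, Finset.prod_const, ← Real.exp_nat_mul]
      congr 1
      ring
    rw [this]
    refine Finset.prod_le_prod ?_ ?_
    · intro i _
      by_cases hi : i ∈ T
      · simp [hi, h1]
      · simp [hi]
    · intro i _
      have := Real.add_one_le_exp (-q)
      by_cases hi : i ∈ T <;> simp [hi]
      linarith

end Bernoulli

/-! ### From joint failure of sets of variables to the number of failing variables. -/

theorem choose_le_exp_mul_div_pow (n s : ℕ) (hs : 0 < s) :
    (n.choose s : ℝ) ≤ (Real.exp 1 * n / s) ^ s := by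
  have h1 := Nat.choose_le_pow_div (α := ℝ) s n
  have h2 := Real.pow_div_factorial_le_exp (s : ℝ) (by positivity) s
  have hs' : (0 : ℝ) < s := by exact_mod_cast hs
  have hf : (0 : ℝ) < s.factorial := by exact_mod_cast Nat.factorial_pos s
  have hexp : Real.exp s = Real.exp 1 ^ s := by rw [← Real.exp_nat_mul]; simp
  refine h1.trans ?_
  rw [mul_div_assoc, mul_pow, div_pow, ← hexp, div_le_iff₀ hf]
  rw [div_le_iff₀ hf] at h2
  calc (n : ℝ) ^ s = (s : ℝ) ^ s * ((n : ℝ) ^ s / (s : ℝ) ^ s) := by field_simp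
    _ ≤ (Real.exp s * s.factorial) * ((n : ℝ) ^ s / (s : ℝ) ^ s) := by gcongr
    _ = _ := by ring

/-- If every set `X` of variables fails simultaneously with probability at most
`exp (-4 y |X|)`, then more than `exp (-y) n / 4` variables fail with probability at most
`4 / (n y)`. -/
theorem bernProb_many_fail_le {ι : Type*} [Fintype ι] [DecidableEq ι] {q : ℝ} (h0 : 0 ≤ q)
    (h1 : q ≤ 1) {n : ℕ} (hn : 0 < n) {y : ℝ} (hy : 3 ≤ y)
    (fail : (ι → Bool) → Finset (Fin n))
    (hfail : ∀ X : Finset (Fin n),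
      bernProb q (fun b => X ⊆ fail b) ≤ Real.exp (-(4 * y * X.card))) :
    bernProb q (fun b => Real.exp (-y) * n / 4 < (fail b).card) ≤ 4 / (n * y) := by
  classical
  -- The least integer above the threshold: too many failures means that some set of exactly s
  -- variables fails.
  set s : ℕ := ⌊Real.exp (-y) * n / 4⌋₊ + 1 with hs
  have hs0 : 0 < s := Nat.succ_pos _
  have hs1 : (1 : ℝ) ≤ s := by exact_mod_cast hs0
  have hn' : (0 : ℝ) < n := by exact_mod_cast hn
  have hsr : Real.exp (-y) * n / 4 < s := by
    rw [hs]; push_cast; exact Nat.lt_floor_add_one _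
  have hsn : (n : ℝ) < 4 * s * Real.exp y := by
    have h : Real.exp (-y) * Real.exp y = 1 := by rw [← Real.exp_add]; simp
    have := mul_lt_mul_of_pos_right hsr (Real.exp_pos y)
    nlinarith
  have step : bernProb q (fun b => Real.exp (-y) * n / 4 < (fail b).card)
      ≤ ∑ X ∈ Finset.powersetCard s Finset.univ, bernProb q (fun b => X ⊆ fail b) := by
    refine le_trans (bernProb_mono h0 h1 ?_)
      (bernProb_exists_le h0 h1 _ fun X b => X ⊆ fail b)
    intro b hb
    have hle : s ≤ (fail b).card := by
      rw [hs, Nat.succ_le_iff]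
      exact (Nat.floor_lt (by positivity)).2 hb
    obtain ⟨X, hX, hXs⟩ := Finset.exists_subset_card_eq hle
    exact ⟨X, by simp [Finset.mem_powersetCard, hXs], hX⟩
  have hsum : ∑ X ∈ Finset.powersetCard s (Finset.univ : Finset (Fin n)),
      bernProb q (fun b => X ⊆ fail b) ≤ n.choose s * Real.exp (-(4 * y * s)) := by
    refine (Finset.sum_le_card_nsmul _ _ (Real.exp (-(4 * y * s))) ?_).trans_eq ?_
    · intro X hX
      rw [Finset.mem_powersetCard] at hX
      simpa [hX.2] using hfail X
    · simp [Finset.card_powersetCard]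
  -- Since n < 4s·e^y, the base en/s is below e^(1+2+y), and y ≥ 3 absorbs the 3.
  have hchoose : (n.choose s : ℝ) ≤ Real.exp (2 * y * s) := by
    refine (choose_le_exp_mul_div_pow n s hs0).trans ?_
    have h4 : (4 : ℝ) ≤ Real.exp 2 := by
      have := Real.quadratic_le_exp_of_nonneg (x := 2) (by norm_num)
      linarith
    have hb : Real.exp 1 * n / s ≤ Real.exp (2 * y) := by
      rw [div_le_iff₀ (by linarith)]
      calc Real.exp 1 * n ≤ Real.exp 1 * (4 * s * Real.exp y) := by gcongr
        _ ≤ Real.exp 1 * (Real.exp 2 * s * Real.exp y) := by gcongr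
        _ = Real.exp (1 + 2 + y) * s := by rw [Real.exp_add, Real.exp_add]; ring
        _ ≤ Real.exp (2 * y) * s := by gcongr; linarith
    calc (Real.exp 1 * n / s) ^ s ≤ Real.exp (2 * y) ^ s := by gcongr
      _ = Real.exp (2 * y * s) := by rw [← Real.exp_nat_mul]; congr 1; ring
  -- The remaining factor e^(-2ys) is split in two halves, one paying for n/4 and one for y.
  have hA : (n : ℝ) / 4 ≤ Real.exp (y * s) := by
    have e1 : Real.exp (y * s) = Real.exp y * Real.exp (y * (s - 1)) := by
      rw [← Real.exp_add]; congr 1; ring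
    have e2 := Real.add_one_le_exp (y * (s - 1))
    have e3 : (s : ℝ) ≤ Real.exp (y * (s - 1)) := by nlinarith
    rw [e1]
    have := mul_le_mul_of_nonneg_left e3 (Real.exp_pos y).le
    linarith
  have hB : y ≤ Real.exp (y * s) := by
    have := Real.add_one_le_exp (y * s)
    nlinarith
  calc _ ≤ n.choose s * Real.exp (-(4 * y * s)) := step.trans hsum
    _ ≤ Real.exp (2 * y * s) * Real.exp (-(4 * y * s)) := by gcongr
    _ = 1 / (Real.exp (y * s) * Real.exp (y * s)) := by
        rw [← Real.exp_add, ← Real.exp_add, one_div, ← Real.exp_neg]; congr 1; ring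
    _ ≤ 1 / (n / 4 * y) := by gcongr
    _ = 4 / (n * y) := by field_simp

/-! ### Deterministic properties of scanning; frozen variables. -/

section Scanning

variable {n : ℕ}

open Classical in
/-- Add the clause `C` to `F` if the result is satisfiable. -/
noncomputable def tryInsert (F : Formula n) (C : Clause n) : Formula n :=
  if Satisfiable (insert C F) then insert C F else F

/-- Scan the clauses in the list `l`, starting from the formula `F`, and add each of them unless
the formula becomes unsatisfiable. -/
noncomputable def scan (F : Formula n) (l : List (Clause n)) : Formula n :=
  l.foldl tryInsert F

theorem process_eq_scan (σ : Ordering n) (coin : Clause n → Bool) :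
    process σ coin = scan ∅ ((List.ofFn σ).filter coin) := by
  rw [scan, List.foldl_filter, process]
  congr 1
  funext F C
  by_cases h1 : coin C = true <;> by_cases h2 : Satisfiable (insert C F) <;>
    simp [tryInsert, h1, h2]

theorem scan_append (F : Formula n) (l l' : List (Clause n)) :
    scan F (l ++ l') = scan (scan F l) l' := List.foldl_append ..

theorem scan_cons (F : Formula n) (C : Clause n) (l : List (Clause n)) :
    scan F (C :: l) = scan (tryInsert F C) l := rfl

theorem Satisfies.mono {ψ : Assignment n} {F G : Formula n} (h : Satisfies ψ G) (hFG : F ⊆ G) :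
    Satisfies ψ F := fun C hC => h C (hFG hC)

theorem Satisfiable.mono {F G : Formula n} (h : Satisfiable G) (hFG : F ⊆ G) :
    Satisfiable F := h.imp fun _ hψ => hψ.mono hFG

theorem subset_tryInsert (F : Formula n) (C : Clause n) : F ⊆ tryInsert F C := by
  unfold tryInsert
  split_ifs
  exacts [Finset.subset_insert _ _, subset_rfl]

theorem tryInsert_subset (F : Formula n) (C : Clause n) : tryInsert F C ⊆ insert C F := by
  unfold tryInsert
  split_ifs
  exacts [subset_rfl, Finset.subset_insert _ _]

theorem subset_scan (F : Formula n) (l : List (Clause n)) : F ⊆ scan F l := by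
  induction l generalizing F with
  | nil => exact subset_rfl
  | cons C l ih => exact (subset_tryInsert F C).trans (ih _)

theorem scan_subset (F : Formula n) (l : List (Clause n)) : scan F l ⊆ F ∪ l.toFinset := by
  induction l generalizing F with
  | nil => simp [scan]
  | cons C l ih =>
    rw [scan_cons]
    refine (ih _).trans ?_
    intro D hD
    simp only [Finset.mem_union, List.mem_toFinset, List.mem_cons] at hD ⊢
    rcases hD with hD | hD
    · have := tryInsert_subset F C hD
      rw [Finset.mem_insert] at this
      tauto
    · tauto

theorem satisfiable_scan {F : Formula n} (hF : Satisfiable F) (l : List (Clause n)) :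
    Satisfiable (scan F l) := by
  induction l generalizing F with
  | nil => exact hF
  | cons C l ih =>
    refine ih ?_
    unfold tryInsert
    split_ifs with h
    exacts [h, hF]

theorem satisfiable_empty : Satisfiable (∅ : Formula n) :=
  ⟨fun _ => true, fun C hC => absurd hC (Finset.notMem_empty C)⟩

/-- A scanned clause that was rejected contradicts the final formula. -/
theorem mem_scan_of_satisfiable {F : Formula n} {l : List (Clause n)} {C : Clause n} (hC : C ∈ l)
    (h : Satisfiable (insert C (scan F l))) : C ∈ scan F l := by
  induction l generalizing F with
  | nil => simp at hC
  | cons D l ih =>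
    rw [scan_cons] at h ⊢
    rcases List.mem_cons.1 hC with rfl | hC
    · apply subset_scan
      rw [tryInsert, if_pos]
      · exact Finset.mem_insert_self _ _
      · exact h.mono (Finset.insert_subset_insert _
          ((subset_tryInsert F C).trans (subset_scan _ _)))
    · exact ih hC h

/-- An assignment satisfying the outcome and `C` witnesses that `C` was compatible whenever it was
scanned. This removes the scanning order from all later arguments. -/
theorem mem_scan_of_satisfies {F : Formula n} {l : List (Clause n)} {C : Clause n} (hC : C ∈ l)
    {ψ : Assignment n} (hψ : Satisfies ψ (scan F l)) (h : ∃ x ∈ C.1, ψ x.1 = x.2) :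
    C ∈ scan F l := by
  refine mem_scan_of_satisfiable hC ⟨ψ, fun D hD => ?_⟩
  rcases Finset.mem_insert.1 hD with rfl | hD
  exacts [h, hψ D hD]

/-- Scanning a clause again has no effect. -/
theorem scan_filter_of_saturated {F : Formula n} (P : Clause n → Bool)
    (hF : ∀ C, P C = true → Satisfiable (insert C F) → C ∈ F) (l : List (Clause n)) :
    scan F (l.filter fun C => !P C) = scan F l := by
  induction l generalizing F with
  | nil => rfl
  | cons C l ih =>
    rw [scan_cons]
    by_cases hC : P C = true
    · have : tryInsert F C = F := by
        unfold tryInsert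
        split_ifs with h
        · exact Finset.insert_eq_self.2 (hF C hC h)
        · rfl
      rw [List.filter_cons_of_neg (by simp [hC]), this, ih hF]
    · rw [List.filter_cons_of_pos (by simpa using hC), scan_cons]
      refine ih fun D hD h => subset_tryInsert F C (hF D hD (h.mono ?_))
      exact Finset.insert_subset_insert _ (subset_tryInsert F C)

theorem scan_append_filter (l l' : List (Clause n)) (P : Clause n → Bool)
    (hP : ∀ C, P C = true → C ∈ l) :
    scan ∅ (l ++ l'.filter fun C => !P C) = scan ∅ (l ++ l') := by
  rw [scan_append, scan_append, scan_filter_of_saturated]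
  exact fun C hC h => mem_scan_of_satisfiable (hP C hC) h

/-- All satisfying assignments of `F` agree on the variable `x`. -/
def Frozen (F : Formula n) (x : Fin n) : Prop :=
  ∀ ψ φ : Assignment n, Satisfies ψ F → Satisfies φ F → ψ x = φ x

open Classical in
/-- The set of variables on which the satisfying assignments of `F` do not all agree. -/
noncomputable def unfrozen (F : Formula n) : Finset (Fin n) :=
  Finset.univ.filter fun x => ¬ Frozen F x

theorem mem_unfrozen {F : Formula n} {x : Fin n} : x ∈ unfrozen F ↔ ¬ Frozen F x := by
  simp [unfrozen]

theorem eq_of_notMem_unfrozen {F : Formula n} {x : Fin n} (hx : x ∉ unfrozen F)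
    {ψ φ : Assignment n} (hψ : Satisfies ψ F) (hφ : Satisfies φ F) : ψ x = φ x := by
  rw [mem_unfrozen, not_not] at hx
  exact hx ψ φ hψ hφ

theorem unfrozen_anti {F G : Formula n} (h : F ⊆ G) : unfrozen G ⊆ unfrozen F := by
  intro x hx
  rw [mem_unfrozen] at hx ⊢
  exact fun hF => hx fun ψ φ hψ hφ => hF ψ φ (hψ.mono h) (hφ.mono h)

end Scanning

/-! ### Counting clauses with prescribed variables and signs. -/

section Counting

variable {n : ℕ}

/-- The set of variables of a clause. -/
def clauseVars (C : Clause n) : Finset (Fin n) := C.1.image Prod.fst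

theorem card_clauseVars (C : Clause n) : (clauseVars C).card = 3 := C.2.2

theorem mem_clauseVars_of_mem {C : Clause n} {l : Literal n} (h : l ∈ C.1) :
    l.1 ∈ clauseVars C := Finset.mem_image_of_mem _ h

/-- The clauses whose set of variables belongs to `T` and whose literals are all true
under `χ`. -/
def aligned (χ : Assignment n) (T : Finset (Finset (Fin n))) : Finset (Clause n) :=
  Finset.univ.filter fun C => clauseVars C ∈ T ∧ ∀ l ∈ C.1, l.2 = χ l.1

theorem mem_aligned {χ : Assignment n} {T : Finset (Finset (Fin n))} {C : Clause n} :
    C ∈ aligned χ T ↔ clauseVars C ∈ T ∧ ∀ l ∈ C.1, l.2 = χ l.1 := by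
  simp [aligned]

theorem mem_of_mem_aligned {χ : Assignment n} {T : Finset (Finset (Fin n))} {C : Clause n}
    (hC : C ∈ aligned χ T) {x : Fin n} (hx : x ∈ clauseVars C) : (x, χ x) ∈ C.1 := by
  obtain ⟨l, hl, rfl⟩ := Finset.mem_image.1 hx
  rw [← (mem_aligned.1 hC).2 l hl]
  exact hl

/-- Each triple of variables carries a clause whose signs are dictated by `χ`. -/
theorem card_le_card_aligned (χ : Assignment n) {T : Finset (Finset (Fin n))}
    (hT : ∀ t ∈ T, t.card = 3) : T.card ≤ (aligned χ T).card := by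
  have hsub : T ⊆ (aligned χ T).image clauseVars := by
    intro t ht
    have himg : (t.image fun y => (y, χ y)).image Prod.fst = t := by
      rw [Finset.image_image]
      simp [Function.comp_def]
    have hcard : (t.image fun y => (y, χ y)).card = 3 := by
      rw [Finset.card_image_of_injective _ fun a b h => (Prod.ext_iff.1 h).1, hT t ht]
    let C : Clause n := ⟨t.image fun y => (y, χ y), hcard, by rw [himg, hT t ht]⟩
    refine Finset.mem_image.2 ⟨C, mem_aligned.2 ⟨?_, ?_⟩, himg⟩
    · change (t.image fun y => (y, χ y)).image Prod.fst ∈ T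
      rwa [himg]
    · intro l hl
      obtain ⟨y, _, rfl⟩ := Finset.mem_image.1 hl
      rfl
  exact (Finset.card_le_card hsub).trans Finset.card_image_le

/-- The sets consisting of an element of `X` and two elements of `Y`. -/
def star (X Y : Finset (Fin n)) : Finset (Finset (Fin n)) :=
  (X ×ˢ Y.powersetCard 2).image fun a => insert a.1 a.2

theorem mem_star {X Y t : Finset (Fin n)} :
    t ∈ star X Y ↔ ∃ x ∈ X, ∃ u ⊆ Y, u.card = 2 ∧ insert x u = t := by
  simp only [star, Finset.mem_image, Finset.mem_product, Finset.mem_powersetCard, Prod.exists]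
  constructor
  · rintro ⟨x, u, ⟨hx, hu, hu2⟩, h⟩
    exact ⟨x, hx, u, hu, hu2, h⟩
  · rintro ⟨x, hx, u, hu, hu2, h⟩
    exact ⟨x, u, ⟨hx, hu, hu2⟩, h⟩

theorem card_of_mem_star {X Y : Finset (Fin n)} (h : Disjoint X Y) {t : Finset (Fin n)}
    (ht : t ∈ star X Y) : t.card = 3 := by
  obtain ⟨x, hx, u, hu, hu2, rfl⟩ := mem_star.1 ht
  rw [Finset.card_insert_of_notMem fun hxu => Finset.disjoint_left.1 h hx (hu hxu), hu2]

theorem card_star {X Y : Finset (Fin n)} (h : Disjoint X Y) :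
    (star X Y).card = X.card * Y.card.choose 2 := by
  rw [star, Finset.card_image_of_injOn, Finset.card_product, Finset.card_powersetCard]
  rintro ⟨x, u⟩ hxu ⟨x', u'⟩ hxu' heq
  simp only [Finset.coe_product, Set.mem_prod, Finset.mem_coe, Finset.mem_powersetCard]
    at hxu hxu'
  dsimp only at heq
  have hd := Finset.disjoint_left.1 h
  have hxx : x = x' := by
    have : x ∈ insert x' u' := heq ▸ Finset.mem_insert_self x u
    rcases Finset.mem_insert.1 this with h | h
    exacts [h, absurd (hxu'.2.1 h) (hd hxu.1)]
  subst hxx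
  have : u = u' := by
    rw [← Finset.erase_insert fun h => hd hxu.1 (hxu.2.1 h), heq,
      Finset.erase_insert fun h => hd hxu.1 (hxu'.2.1 h)]
  rw [this]

theorem card_le_card_aligned_star (χ : Assignment n) {X Y : Finset (Fin n)} (h : Disjoint X Y) :
    X.card * Y.card.choose 2 ≤ (aligned χ (star X Y)).card := by
  rw [← card_star h]
  exact card_le_card_aligned χ fun t ht => card_of_mem_star h ht

/-- The clauses in which the variable `x` appears. -/
def clausesAt (x : Fin n) : Finset (Clause n) := Finset.univ.filter fun C => x ∈ clauseVars C

theorem mem_clausesAt {x : Fin n} {C : Clause n} : C ∈ clausesAt x ↔ x ∈ clauseVars C := by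
  simp [clausesAt]

theorem card_clausesAt_le (x : Fin n) : (clausesAt x).card ≤ 8 * n ^ 2 := by
  rw [← Finset.card_map (Function.Embedding.subtype _)]
  have hsub : (clausesAt x).map (Function.Embedding.subtype _) ⊆
      -- A crude count: two signs for `x` and 2n choices for each of the other two literals.
      (Finset.univ : Finset (Bool × Literal n × Literal n)).image
        fun a => {(x, a.1), a.2.1, a.2.2} := by
    intro S hS
    obtain ⟨C, hC, rfl⟩ := Finset.mem_map.1 hS
    obtain ⟨⟨y, b⟩, hl, rfl⟩ := Finset.mem_image.1 (mem_clausesAt.1 hC)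
    have h2 : (C.1.erase (y, b)).card = 2 := by rw [Finset.card_erase_of_mem hl, C.2.1]
    obtain ⟨l₁, l₂, _, h⟩ := Finset.card_eq_two.1 h2
    refine Finset.mem_image.2 ⟨(b, l₁, l₂), Finset.mem_univ _, ?_⟩
    change {(y, b), l₁, l₂} = C.1
    rw [← h, Finset.insert_erase hl]
  refine (Finset.card_le_card hsub).trans (Finset.card_image_le.trans_eq ?_)
  simp
  ring

/-- Negate the variable `x` in a literal. -/
def flipLiteral (x : Fin n) : Literal n ↪ Literal n where
  toFun l := (l.1, if l.1 = x then !l.2 else l.2)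
  inj' := by
    rintro ⟨y, b⟩ ⟨z, c⟩ h
    simp only [Prod.mk.injEq] at h
    obtain ⟨rfl, h⟩ := h
    split_ifs at h
    · simpa using h
    · rw [h]

/-- Negate the variable `x` in a clause. -/
def flipClause (x : Fin n) (C : Clause n) : Clause n :=
  ⟨C.1.map (flipLiteral x), by rw [Finset.card_map]; exact C.2.1, by
    rw [Finset.map_eq_image, Finset.image_image]
    exact C.2.2⟩

theorem card_occurrences_univ_le (x : Fin n) (b : Bool) :
    (occurrences Finset.univ (x, b)).card ≤ (occurrences Finset.univ (x, !b)).card := by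
  refine Finset.card_le_card_of_injOn (flipClause x) ?_ ?_
  · intro C hC
    rw [Finset.mem_coe, occurrences, Finset.mem_filter] at hC ⊢
    refine ⟨Finset.mem_univ _, Finset.mem_map.2 ⟨(x, b), hC.2, ?_⟩⟩
    change ((x, if x = x then !b else b) : Literal n) = (x, !b)
    simp
  · intro C _ D _ h
    exact Subtype.ext (Finset.map_injective _ (Subtype.ext_iff.1 h))

theorem card_occurrences_univ_not (x : Fin n) (b : Bool) :
    (occurrences Finset.univ (x, !b)).card = (occurrences Finset.univ (x, b)).card :=
  le_antisymm (by simpa using card_occurrences_univ_le x (!b)) (card_occurrences_univ_le x b)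

end Counting

/-! ### Equivalence of the process with three successive rounds. -/

section Coupling

/-- A coin toss with success probability `r` is the disjunction of two independent tosses with
success probabilities `s` and `t`, if `1 - r = (1 - s) * (1 - t)`. -/
theorem bernProb_eq_sum_bernProb_or {ι : Type*} [Fintype ι] [DecidableEq ι] {r s t : ℝ}
    (h : 1 - r = (1 - s) * (1 - t)) (A : (ι → Bool) → Prop) :
    bernProb r A = ∑ b, bernWeight s b * bernProb t fun b' => A fun i => b i || b' i := by
  classical
  have key : ∀ c : ι → Bool, bernWeight r c = ∑ b, bernWeight s b * ∑ b', bernWeight t b' *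
      (if (fun i => b i || b' i) = c then (1 : ℝ) else 0) := by
    intro c
    have hind : ∀ b b' : ι → Bool, (if (fun i => b i || b' i) = c then (1 : ℝ) else 0)
        = ∏ i, if (b i || b' i) = c i then 1 else 0 := by
      intro b b'
      rw [Finset.prod_ite_zero]
      simp [funext_iff]
    simp only [hind]
    have h1 : ∀ b : ι → Bool,
        ∑ b', bernWeight t b' * ∏ i, (if (b i || b' i) = c i then (1 : ℝ) else 0) = _ :=
      fun b => sum_bernWeight_mul_prod t fun i y => if (b i || y) = c i then 1 else 0
    simp only [h1]
    have h2 := sum_bernWeight_mul_prod (ι := ι) s fun i x =>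
      t * (if (x || true) = c i then 1 else 0) + (1 - t) * (if (x || false) = c i then 1 else 0)
    rw [h2, bernWeight]
    refine Finset.prod_congr rfl fun i _ => ?_
    cases c i
    · simp; linarith
    · simp; linarith
  rw [bernProb]
  simp only [key, bernProb, Finset.sum_mul, Finset.mul_sum]
  rw [Finset.sum_comm]
  refine Finset.sum_congr rfl fun b _ => ?_
  rw [Finset.sum_comm]
  refine Finset.sum_congr rfl fun b' _ => ?_
  rw [Finset.sum_eq_single fun i => b i || b' i]
  · simp
  · intro c _ hc
    simp [Ne.symm hc]
  · simp

theorem sum_bernWeight_comp {α β : Type*} [Fintype α] [Fintype β] [DecidableEq α]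
    [DecidableEq β] (σ : α ≃ β) (q : ℝ) (f : (β → Bool) → ℝ) :
    ∑ b, bernWeight q b * f b = ∑ c : α → Bool, bernWeight q c * f (c ∘ σ.symm) := by
  rw [← Equiv.sum_comp (σ.arrowCongr (Equiv.refl Bool))]
  refine Finset.sum_congr rfl fun c _ => ?_
  have : (σ.arrowCongr (Equiv.refl Bool)) c = c ∘ σ.symm := rfl
  rw [this, bernWeight, bernWeight, ← Equiv.prod_comp σ]
  simp

/-- The average of `f` over three independent families of coin tosses. -/
noncomputable def tripleAverage {ι : Type*} [Fintype ι] [DecidableEq ι] (q₁ q₂ q₃ : ℝ)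
    (f : (ι → Bool) → (ι → Bool) → (ι → Bool) → ℝ) : ℝ :=
  ∑ b₁, bernWeight q₁ b₁ * ∑ b₂, bernWeight q₂ b₂ * ∑ b₃, bernWeight q₃ b₃ * f b₁ b₂ b₃

theorem tripleAverage_comp {α β : Type*} [Fintype α] [Fintype β] [DecidableEq α]
    [DecidableEq β] (σ : α ≃ β) (q₁ q₂ q₃ : ℝ)
    (f : (β → Bool) → (β → Bool) → (β → Bool) → ℝ) :
    tripleAverage q₁ q₂ q₃ f = tripleAverage q₁ q₂ q₃ fun c₁ c₂ c₃ =>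
      f (c₁ ∘ σ.symm) (c₂ ∘ σ.symm) (c₃ ∘ σ.symm) := by
  simp only [tripleAverage]
  rw [sum_bernWeight_comp σ]
  refine Finset.sum_congr rfl fun c₁ _ => ?_
  rw [sum_bernWeight_comp σ]
  congr 1
  refine Finset.sum_congr rfl fun c₂ _ => ?_
  rw [sum_bernWeight_comp σ]

theorem sum_tripleAverage {ι κ : Type*} [Fintype ι] [DecidableEq ι] [Fintype κ] (q₁ q₂ q₃ : ℝ)
    (f : κ → (ι → Bool) → (ι → Bool) → (ι → Bool) → ℝ) :
    ∑ k, tripleAverage q₁ q₂ q₃ (f k)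
      = tripleAverage q₁ q₂ q₃ fun b₁ b₂ b₃ => ∑ k, f k b₁ b₂ b₃ := by
  simp only [tripleAverage, Finset.mul_sum]
  rw [Finset.sum_comm]
  refine Finset.sum_congr rfl fun b₁ _ => ?_
  rw [Finset.sum_comm]
  refine Finset.sum_congr rfl fun b₂ _ => ?_
  rw [Finset.sum_comm]

theorem exists_perm_map_eq {α : Type*} [DecidableEq α] {l l' : List α} (hl : l.Nodup)
    (hl' : l'.Nodup) (hlen : l.length = l'.length) : ∃ e : Equiv.Perm α, l.map e = l' := by
  let x : Fin l.length ↪ α := ⟨l.get, List.nodup_iff_injective_get.1 hl⟩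
  let y : Fin l.length ↪ α := ⟨fun i => l'.get (i.cast hlen), fun i j h => by
    simpa using List.nodup_iff_injective_get.1 hl' h⟩
  obtain ⟨e, he⟩ := (Equiv.Perm.isMultiplyPretransitive α l.length).exists_smul_eq x y
  refine ⟨e, List.ext_getElem (by simpa using hlen) fun i h1 h2 => ?_⟩
  have := DFunLike.congr_fun he ⟨i, by simpa using h1⟩
  simpa [x, y] using this

/-- The elements of `l` selected by `c₁`, followed by those selected by `c₂` and by `c₃`,
without repetitions. -/
def concatFilter {α : Type*} (l : List α) (c₁ c₂ c₃ : α → Bool) : List α :=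
  l.filter c₁ ++ ((l.filter c₂).filter fun i => !c₁ i) ++
    ((l.filter c₃).filter fun i => !(c₁ i || c₂ i))

theorem map_concatFilter {α β : Type*} (σ : α ≃ β) (l : List α) (c₁ c₂ c₃ : α → Bool) :
    (concatFilter l c₁ c₂ c₃).map σ
      = concatFilter (l.map σ) (c₁ ∘ σ.symm) (c₂ ∘ σ.symm) (c₃ ∘ σ.symm) := by
  simp [concatFilter, List.filter_map, Function.comp_def]

/-- Both lists enumerate the same elements without repetition, so a permutation of the ground set
carries one to the other. -/
theorem exists_perm_map_filter_eq {α : Type*} [DecidableEq α] {l : List α} (hl : l.Nodup)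
    (c₁ c₂ c₃ : α → Bool) : ∃ e : Equiv.Perm α,
      (l.filter fun i => c₁ i || (c₂ i || c₃ i)).map e = concatFilter l c₁ c₂ c₃ := by
  have hnd : (concatFilter l c₁ c₂ c₃).Nodup := by
    rw [concatFilter, List.nodup_append, List.nodup_append]
    refine ⟨⟨hl.filter _, (hl.filter _).filter _, ?_⟩, (hl.filter _).filter _, ?_⟩
    · rintro a ha b hb rfl
      simp only [List.mem_filter] at ha hb
      simp [ha.2] at hb
    · rintro a ha b hb rfl
      simp only [List.mem_append, List.mem_filter] at ha hb
      rcases ha with ha | ha <;> simp [ha.2] at hb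
      simp [ha.1.2] at hb
  refine exists_perm_map_eq (hl.filter _) hnd (List.Perm.length_eq ?_)
  rw [List.perm_ext_iff_of_nodup (hl.filter _) hnd]
  intro a
  simp only [concatFilter, List.mem_append, List.mem_filter]
  cases c₁ a <;> cases c₂ a <;> cases c₃ a <;> simp

/-- Clauses selected again in a later round are already accepted or permanently rejected, so
removing the repetitions does not change the outcome. -/
theorem scan_concatFilter {n : ℕ} (l : List (Clause n)) (b₁ b₂ b₃ : Clause n → Bool) :
    scan ∅ (concatFilter l b₁ b₂ b₃)
      = scan ∅ (l.filter b₁ ++ l.filter b₂ ++ l.filter b₃) := by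
  -- `scan_append_filter` asks that every removed clause occur in the earlier list; intersecting the
  -- predicate with membership secures this.
  have h1 : ∀ l' : List (Clause n), (l'.filter fun C => !b₁ C)
      = l'.filter fun C => !(b₁ C && decide (C ∈ l')) := by
    intro l'
    refine List.filter_congr fun C hC => ?_
    simp [hC]
  have e2 : scan ∅ (l.filter b₁ ++ ((l.filter b₂).filter fun C => !b₁ C))
      = scan ∅ (l.filter b₁ ++ l.filter b₂) := by
    rw [h1]
    refine scan_append_filter _ _ (fun C => b₁ C && decide (C ∈ l.filter b₂)) fun C hC => ?_
    simp only [Bool.and_eq_true, decide_eq_true_eq, List.mem_filter] at hC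
    exact List.mem_filter.2 ⟨hC.2.1, hC.1⟩
  have e3 : (l.filter b₃).filter (fun C => !(b₁ C || b₂ C))
      = (l.filter b₃).filter fun C => !((b₁ C || b₂ C) && decide (C ∈ l)) := by
    refine List.filter_congr fun C hC => ?_
    simp [(List.mem_filter.1 hC).1]
  rw [concatFilter, scan_append, e2, ← scan_append, e3]
  refine scan_append_filter _ _ (fun C => (b₁ C || b₂ C) && decide (C ∈ l)) fun C hC => ?_
  simp only [Bool.and_eq_true, Bool.or_eq_true, decide_eq_true_eq] at hC
  rw [List.mem_append, List.mem_filter, List.mem_filter]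
  tauto

/-- Attach the coins to positions instead of clauses. For fixed coins, a permutation `e` of the
positions turns the single-round list into the three-round list, and `σ ↦ e.trans σ` is a bijection
of the orderings. -/
theorem sum_tripleAverage_or {N : ℕ} {β : Type*} [Fintype β] [DecidableEq β] (q₁ q₂ q₃ : ℝ)
    (h : List β → ℝ) :
    ∑ σ : Fin N ≃ β, tripleAverage q₁ q₂ q₃ (fun b₁ b₂ b₃ =>
        h ((List.ofFn σ).filter fun C => b₁ C || (b₂ C || b₃ C)))
      = ∑ σ : Fin N ≃ β, tripleAverage q₁ q₂ q₃ (fun b₁ b₂ b₃ =>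
        h (concatFilter (List.ofFn σ) b₁ b₂ b₃)) := by
  have e1 : ∀ σ : Fin N ≃ β, tripleAverage q₁ q₂ q₃ (fun b₁ b₂ b₃ =>
        h ((List.ofFn σ).filter fun C => b₁ C || (b₂ C || b₃ C)))
      = tripleAverage q₁ q₂ q₃ fun c₁ c₂ c₃ =>
        h (((List.finRange N).filter fun i => c₁ i || (c₂ i || c₃ i)).map σ) := by
    intro σ
    rw [tripleAverage_comp σ]
    simp [List.ofFn_eq_map, List.filter_map, Function.comp_def]
  have e2 : ∀ σ : Fin N ≃ β, tripleAverage q₁ q₂ q₃ (fun b₁ b₂ b₃ =>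
        h (concatFilter (List.ofFn σ) b₁ b₂ b₃))
      = tripleAverage q₁ q₂ q₃ fun c₁ c₂ c₃ =>
        h ((concatFilter (List.finRange N) c₁ c₂ c₃).map σ) := by
    intro σ
    rw [tripleAverage_comp σ]
    simp only [map_concatFilter, List.ofFn_eq_map]
  simp only [e1, e2, sum_tripleAverage]
  congr 1
  funext c₁ c₂ c₃
  obtain ⟨e, he⟩ := exists_perm_map_filter_eq (List.nodup_finRange N) c₁ c₂ c₃
  let E : (Fin N ≃ β) ≃ (Fin N ≃ β) :=
    ⟨fun σ => e.trans σ, fun σ => e.symm.trans σ, fun σ => by ext; simp, fun σ => by ext; simp⟩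
  refine (Fintype.sum_equiv E _ _ fun σ => ?_).symm
  rw [← he, List.map_map]
  rfl

theorem toReal_coins_map_toOuterMeasure {n : ℕ} (p : unitInterval) (σ : Ordering n)
    (A : Formula n → Prop) :
    (((coins n p).map (process σ)).toOuterMeasure {F | A F}).toReal
      = bernProb (p : ℝ) fun coin => A (process σ coin) := by
  classical
  rw [PMF.toOuterMeasure_map_apply, coins, PMF.toOuterMeasure_ofFintype_apply,
    tsum_fintype, ENNReal.toReal_sum, bernProb]
  · refine Finset.sum_congr rfl fun b _ => ?_
    by_cases hb : A (process σ b)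
    · rw [Set.indicator_of_mem (by exact hb), if_pos hb, mul_one, ENNReal.toReal_prod,
        bernWeight]
      refine Finset.prod_congr rfl fun C _ => ?_
      split_ifs
      · exact ENNReal.toReal_ofReal p.2.1
      · exact ENNReal.toReal_ofReal (by linarith [p.2.2])
    · rw [Set.indicator_of_notMem (by exact hb), if_neg hb]
      simp
  · intro b _
    refine ((Set.indicator_le_self _ _ b).trans_lt ?_).ne
    refine ENNReal.prod_lt_top fun C _ => ?_
    split_ifs <;> exact ENNReal.ofReal_lt_top

theorem toReal_Psat_toOuterMeasure {n : ℕ} (p : unitInterval) (A : Formula n → Prop) :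
    ((Psat n p).toOuterMeasure {F | A F}).toReal
      = (Fintype.card (Ordering n) : ℝ)⁻¹ *
        ∑ σ : Ordering n, bernProb (p : ℝ) fun coin => A (process σ coin) := by
  classical
  rw [Psat, PMF.toOuterMeasure_bind_apply, tsum_fintype, ENNReal.toReal_sum, Finset.mul_sum]
  · refine Finset.sum_congr rfl fun σ _ => ?_
    rw [ENNReal.toReal_mul, toReal_coins_map_toOuterMeasure, PMF.uniformOfFintype_apply]
    simp
  · intro σ _
    refine ENNReal.mul_ne_top (PMF.apply_ne_top _ _) ?_
    refine ((MeasureTheory.measure_mono (Set.subset_univ _)).trans_lt ?_).ne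
    rw [(PMF.toOuterMeasure_apply_eq_one_iff _ _).2 (Set.subset_univ _)]
    exact ENNReal.one_lt_top

/-- A bound for the failure probability that holds for every ordering, if the coins are tossed in
three independent rounds and the clauses are scanned once per round. -/
theorem toReal_Psat_le {n : ℕ} (p : unitInterval) {q₁ q₂ q₃ : ℝ}
    (hq : 1 - (p : ℝ) = (1 - q₁) * ((1 - q₂) * (1 - q₃))) (A : Formula n → Prop) {δ : ℝ}
    (hδ : ∀ σ : Ordering n, ∑ b₁, bernWeight q₁ b₁ * ∑ b₂, bernWeight q₂ b₂ *
      bernProb q₃ (fun b₃ => A (scan (scan (scan ∅ ((List.ofFn σ).filter b₁))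
        ((List.ofFn σ).filter b₂)) ((List.ofFn σ).filter b₃))) ≤ δ) :
    ((Psat n p).toOuterMeasure {F | A F}).toReal ≤ δ := by
  classical
  rw [toReal_Psat_toOuterMeasure]
  have h1 : ∀ σ : Ordering n, (bernProb (p : ℝ) fun coin => A (process σ coin))
      = tripleAverage q₁ q₂ q₃ (fun b₁ b₂ b₃ =>
        if A (scan ∅ ((List.ofFn σ).filter fun C => b₁ C || (b₂ C || b₃ C))) then 1 else 0) := by
    intro σ
    rw [bernProb_eq_sum_bernProb_or (s := q₁) (t := 1 - (1 - q₂) * (1 - q₃)) (by rw [hq]; ring)]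
    have h2 : ∀ b₁ : Clause n → Bool,
        (bernProb (1 - (1 - q₂) * (1 - q₃)) fun b' => A (process σ fun C => b₁ C || b' C)) = _ :=
      fun b₁ => bernProb_eq_sum_bernProb_or (s := q₂) (t := q₃) (by ring) _
    simp only [h2]
    simp only [process_eq_scan, bernProb, tripleAverage]
  simp only [h1]
  rw [sum_tripleAverage_or q₁ q₂ q₃ fun l => if A (scan ∅ l) then 1 else 0]
  simp only [scan_concatFilter, scan_append]
  have hN : (0 : ℝ) < Fintype.card (Ordering n) := by exact_mod_cast Fintype.card_pos
  rw [inv_mul_le_iff₀ hN, ← nsmul_eq_mul]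
  refine Finset.sum_le_card_nsmul _ _ _ fun σ _ => ?_
  exact hδ σ

end Coupling

/-! ### Round one: all but n/20 of the variables are frozen. -/

section FirstRound

variable {n : ℕ}

/-- The assignment that agrees with `φ` on `D` and disagrees with `φ` off `D`. -/
def agreeOn (φ : Assignment n) (D : Finset (Fin n)) : Assignment n :=
  fun x => if x ∈ D then φ x else !φ x

/-- No selected clause is supported by a single variable of `D`: a clause with exactly one variable
in `D`, whose literal on this variable is its only literal that is true under `φ`. -/
def SelfSupporting (φ : Assignment n) (b : Clause n → Bool) (D : Finset (Fin n)) : Prop :=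
  ∀ C ∈ aligned (agreeOn φ D) (star D Dᶜ), b C = false

/-- A clause with a single variable in `D ∪ E` has it in `D` or in `E`, and its other two variables
avoid both sets; so it is already excluded by one of the hypotheses. -/
theorem SelfSupporting.union {φ : Assignment n} {b : Clause n → Bool} {D E : Finset (Fin n)}
    (hD : SelfSupporting φ b D) (hE : SelfSupporting φ b E) : SelfSupporting φ b (D ∪ E) := by
  have key : ∀ D' ⊆ D ∪ E, SelfSupporting φ b D' → ∀ C : Clause n, ∀ x ∈ D', ∀ u ⊆ (D ∪ E)ᶜ,
      u.card = 2 → insert x u = clauseVars C → (∀ l ∈ C.1, l.2 = agreeOn φ (D ∪ E) l.1) →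
      b C = false := by
    intro D' hD' hs C x hx u hu hu2 hC hl
    have hu' : u ⊆ D'ᶜ := hu.trans (Finset.compl_subset_compl.2 hD')
    refine hs C (mem_aligned.2 ⟨mem_star.2 ⟨x, hx, u, hu', hu2, hC⟩, fun l hlC => ?_⟩)
    rw [hl l hlC]
    have hmem := mem_clauseVars_of_mem hlC
    rw [← hC] at hmem
    rcases Finset.mem_insert.1 hmem with h | h
    · rw [h, agreeOn, agreeOn, if_pos hx, if_pos (hD' hx)]
    · rw [agreeOn, agreeOn, if_neg (Finset.mem_compl.1 (hu' h)),
        if_neg (Finset.mem_compl.1 (hu h))]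
  intro C hC
  obtain ⟨hv, hl⟩ := mem_aligned.1 hC
  obtain ⟨x, hx, u, hu, hu2, h⟩ := mem_star.1 hv
  rcases Finset.mem_union.1 hx with hx | hx
  · exact key D Finset.subset_union_left hD C x hx u hu hu2 h hl
  · exact key E Finset.subset_union_right hE C x hx u hu hu2 h hl

theorem mem_filter_of_forall_mem {L : List (Clause n)} (hL : ∀ C, C ∈ L) {b : Clause n → Bool}
    {C : Clause n} (hC : b C = true) : C ∈ L.filter b :=
  List.mem_filter.2 ⟨hL C, hC⟩

/-- The variables on which two satisfying assignments differ form a self-supporting set. -/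
theorem selfSupporting_of_satisfies {L : List (Clause n)} (hL : ∀ C, C ∈ L) {F : Formula n}
    {b : Clause n → Bool} {φ ψ : Assignment n} (hφ : Satisfies φ (scan F (L.filter b)))
    (hψ : Satisfies ψ (scan F (L.filter b))) :
    SelfSupporting φ b (Finset.univ.filter fun x => ψ x ≠ φ x) := by
  set D := Finset.univ.filter fun x => ψ x ≠ φ x with hD
  have hmem : ∀ x, x ∈ D ↔ ψ x ≠ φ x := by simp [hD]
  intro C hC
  by_contra hb
  rw [Bool.not_eq_false] at hb
  obtain ⟨hv, hl⟩ := mem_aligned.1 hC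
  obtain ⟨x, hx, u, hu, hu2, h⟩ := mem_star.1 hv
  have hxC : (x, agreeOn φ D x) ∈ C.1 :=
    mem_of_mem_aligned hC (h ▸ Finset.mem_insert_self x u)
  have hCF := mem_scan_of_satisfies (mem_filter_of_forall_mem hL hb) hφ
    ⟨_, hxC, by simp [agreeOn, hx]⟩
  obtain ⟨l, hlC, hψl⟩ := hψ C hCF
  rw [hl l hlC, agreeOn] at hψl
  split_ifs at hψl with hlD
  · exact (hmem _).1 hlD hψl
  · rw [hmem, not_not] at hlD
    simp [hlD] at hψl

/-- Fix a satisfying `φ`. By `hlarge` all difference sets from `φ` have fewer than `a` elements. A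
largest self-supporting set of size at most `2 * a` has fewer than `a` by `hmid`; its union with any
difference set is again admissible, so by maximality it contains them all, and with them every
unfrozen variable. -/
theorem card_unfrozen_lt {L : List (Clause n)} (hL : ∀ C, C ∈ L) {b : Clause n → Bool} {a : ℕ}
    (hlarge : ∀ (φ : Assignment n) (D : Finset (Fin n)), a ≤ D.card →
      ∃ C ∈ aligned φ (D.powersetCard 3), b C = true)
    (hmid : ∀ (φ : Assignment n) (D : Finset (Fin n)), a ≤ D.card → D.card ≤ 2 * a →
      ¬ SelfSupporting φ b D) :
    (unfrozen (scan ∅ (L.filter b))).card < a := by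
  classical
  set F := scan ∅ (L.filter b) with hF
  obtain ⟨φ, hφ⟩ : Satisfiable F := satisfiable_scan satisfiable_empty _
  let diff : Assignment n → Finset (Fin n) := fun ψ => Finset.univ.filter fun x => ψ x ≠ φ x
  have hmem : ∀ ψ x, x ∈ diff ψ ↔ ψ x ≠ φ x := by simp [diff]
  have hdiff : ∀ ψ, Satisfies ψ F → (diff ψ).card < a := by
    intro ψ hψ
    by_contra! hle
    obtain ⟨C, hC, hb⟩ := hlarge φ _ hle
    obtain ⟨hv, hl⟩ := mem_aligned.1 hC
    obtain ⟨l, hlC⟩ : C.1.Nonempty := Finset.card_pos.1 (by rw [C.2.1]; norm_num)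
    have hCF := mem_scan_of_satisfies (mem_filter_of_forall_mem hL hb) hφ
      ⟨l, hlC, (hl l hlC).symm⟩
    obtain ⟨l', hlC', hψl⟩ := hψ C hCF
    have hD := (Finset.mem_powersetCard.1 hv).1 (mem_clauseVars_of_mem hlC')
    exact (hmem _ _).1 hD (hψl.trans (hl l' hlC'))
  have hempty : SelfSupporting φ b ∅ := by
    intro C hC
    obtain ⟨x, hx, _⟩ := mem_star.1 (mem_aligned.1 hC).1
    simp at hx
  obtain ⟨D, hD, hmax⟩ := Finset.exists_max_image
    (Finset.univ.filter fun D => SelfSupporting φ b D ∧ D.card ≤ 2 * a) Finset.card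
    ⟨∅, by simp [hempty]⟩
  rw [Finset.mem_filter] at hD
  have hDa : D.card < a := by
    by_contra! hle
    exact hmid φ D hle hD.2.2 hD.2.1
  have hsub : ∀ ψ, Satisfies ψ F → diff ψ ⊆ D := by
    intro ψ hψ
    have hu := hmax (D ∪ diff ψ) (Finset.mem_filter.2 ⟨Finset.mem_univ _,
      hD.2.1.union (selfSupporting_of_satisfies hL hφ hψ),
      (Finset.card_union_le _ _).trans (by have := hdiff ψ hψ; omega)⟩)
    have := Finset.eq_of_subset_of_card_le (Finset.subset_union_left (s₁ := D) (s₂ := diff ψ)) hu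
    rw [this]
    exact Finset.subset_union_right
  refine lt_of_le_of_lt (Finset.card_le_card fun x hx => ?_) hDa
  by_contra hxD
  refine mem_unfrozen.1 hx fun ψ ψ' hψ hψ' => ?_
  have h1 : ψ x = φ x := by
    by_contra h
    exact hxD (hsub ψ hψ ((hmem _ _).2 h))
  have h2 : ψ' x = φ x := by
    by_contra h
    exact hxD (hsub ψ' hψ' ((hmem _ _).2 h))
  rw [h1, h2]

/-- The assignment `φ` depends on the coins, so the union bound runs over all pairs of an assignment
and a set, at most 4ⁿ, once for each hypothesis of `card_unfrozen_lt`. -/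
theorem bernProb_card_unfrozen_le {L : List (Clause n)} (hL : ∀ C, C ∈ L) {q : ℝ} (h0 : 0 ≤ q)
    (h1 : q ≤ 1) {a t : ℕ} (ht₁ : t ≤ a.choose 3)
    (ht₂ : t ≤ a * (n - 2 * a).choose 2) :
    bernProb q (fun b => a ≤ (unfrozen (scan ∅ (L.filter b))).card)
      ≤ 2 * (4 ^ n * Real.exp (-(q * t))) := by
  classical
  let J₁ : Finset (Assignment n × Finset (Fin n)) := Finset.univ.filter fun j => a ≤ j.2.card
  let J₂ : Finset (Assignment n × Finset (Fin n)) :=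
    Finset.univ.filter fun j => a ≤ j.2.card ∧ j.2.card ≤ 2 * a
  have hcard : ∀ J : Finset (Assignment n × Finset (Fin n)), (J.card : ℝ) ≤ 4 ^ n := by
    intro J
    have : J.card ≤ 2 ^ n * 2 ^ n := by
      refine (Finset.card_le_univ J).trans_eq ?_
      simp
    rw [← mul_pow] at this
    exact_mod_cast this
  have bound : ∀ (J : Finset (Assignment n × Finset (Fin n)))
      (T : Assignment n × Finset (Fin n) → Finset (Clause n)), (∀ j ∈ J, t ≤ (T j).card) →
      bernProb q (fun b => ∃ j ∈ J, ∀ C ∈ T j, b C = false)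
        ≤ 4 ^ n * Real.exp (-(q * t)) := by
    intro J T hT
    refine (bernProb_exists_le h0 h1 J fun j b => ∀ C ∈ T j, b C = false).trans ?_
    refine (Finset.sum_le_card_nsmul _ _ (Real.exp (-(q * t))) fun j hj => ?_).trans ?_
    · refine (bernProb_forall_false_le h0 h1 (T j)).trans (Real.exp_le_exp.2 ?_)
      have : (t : ℝ) ≤ (T j).card := by exact_mod_cast hT j hj
      exact neg_le_neg (mul_le_mul_of_nonneg_left this h0)
    · rw [nsmul_eq_mul]
      exact mul_le_mul_of_nonneg_right (hcard J) (Real.exp_pos _).le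
  have b₁ := bound J₁ (fun j => aligned j.1 (j.2.powersetCard 3)) (by
    intro j hj
    rw [Finset.mem_filter] at hj
    refine ht₁.trans ((Nat.choose_le_choose 3 hj.2).trans ?_)
    rw [← Finset.card_powersetCard]
    exact card_le_card_aligned _ fun s hs => (Finset.mem_powersetCard.1 hs).2)
  have b₂ := bound J₂ (fun j => aligned (agreeOn j.1 j.2) (star j.2 j.2ᶜ)) (by
    intro j hj
    rw [Finset.mem_filter] at hj
    refine ht₂.trans (le_trans ?_ (card_le_card_aligned_star _ disjoint_compl_right))
    rw [Finset.card_compl, Fintype.card_fin]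
    exact Nat.mul_le_mul hj.2.1 (Nat.choose_le_choose 2 (by omega)))
  rw [two_mul]
  refine le_trans (bernProb_mono h0 h1 ?_) ((bernProb_or_le h0 h1 _ _).trans (add_le_add b₁ b₂))
  intro b hb
  by_contra! hcon
  refine absurd (card_unfrozen_lt hL ?_ ?_) (not_lt.2 hb)
  · intro φ D hD
    obtain ⟨C, hC, h⟩ := hcon.1 (φ, D) (Finset.mem_filter.2 ⟨Finset.mem_univ _, hD⟩)
    exact ⟨C, hC, by simpa using h⟩
  · intro φ D hD hD' hs
    obtain ⟨C, hC, h⟩ := hcon.2 (φ, D) (Finset.mem_filter.2 ⟨Finset.mem_univ _, hD, hD'⟩)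
    exact h (hs C hC)

end FirstRound

/-! ### Round two: few variables remain unfrozen. -/

section SecondRound

variable {n : ℕ}

/-- A clause on the variable `x` and two frozen variables whose literals are false freezes `x`,
whether it is accepted or rejected. -/
theorem frozen_scan_of_mem_aligned {L : List (Clause n)} (hL : ∀ C, C ∈ L) {F : Formula n}
    {b : Clause n → Bool} {φ : Assignment n} (hφ : Satisfies φ F) {C : Clause n} (hb : b C = true)
    {x : Fin n} {u : Finset (Fin n)} (hu : ∀ y ∈ u, Frozen F y) (hv : clauseVars C = insert x u)
    (hl : ∀ l ∈ C.1, l.2 = !φ l.1) : Frozen (scan F (L.filter b)) x := by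
  have hCL := mem_filter_of_forall_mem hL hb
  by_cases hC : C ∈ scan F (L.filter b)
  · have key : ∀ ψ, Satisfies ψ (scan F (L.filter b)) → ψ x = !φ x := by
      intro ψ hψ
      obtain ⟨l, hlC, hψl⟩ := hψ C hC
      have hmem := mem_clauseVars_of_mem hlC
      rw [hl l hlC] at hψl
      rw [hv, Finset.mem_insert] at hmem
      rcases hmem with h | h
      · rwa [h] at hψl
      · rw [hu _ h ψ φ (hψ.mono (subset_scan _ _)) hφ] at hψl
        simp at hψl
    intro ψ ψ' hψ hψ'
    rw [key ψ hψ, key ψ' hψ']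
  · have key : ∀ ψ, Satisfies ψ (scan F (L.filter b)) → ψ x = φ x := by
      intro ψ hψ
      by_contra hne
      have hx : x ∈ clauseVars C := hv ▸ Finset.mem_insert_self x u
      obtain ⟨l, hlC, rfl⟩ := Finset.mem_image.1 hx
      refine hC (mem_scan_of_satisfies hCL hψ ⟨l, hlC, ?_⟩)
      rw [hl l hlC]
      exact Bool.eq_not_of_ne hne
    intro ψ ψ' hψ hψ'
    rw [key ψ hψ, key ψ' hψ']

/-- If all of `X` stays unfrozen, none of the clauses with one variable in `X`, two frozen variables
and signs opposite to `φ` is selected. These are distinct clauses, so the failures multiply over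
`X`. -/
theorem bernProb_subset_unfrozen_le {L : List (Clause n)} (hL : ∀ C, C ∈ L) {q : ℝ} (h0 : 0 ≤ q)
    (h1 : q ≤ 1) {F : Formula n} (hF : Satisfiable F) (X : Finset (Fin n)) :
    bernProb q (fun b => X ⊆ unfrozen (scan F (L.filter b)))
      ≤ Real.exp (-(q * (X.card * ((unfrozen F)ᶜ.card.choose 2 : ℕ)))) := by
  classical
  obtain ⟨φ, hφ⟩ := hF
  by_cases hX : Disjoint X (unfrozen F)ᶜ
  · refine (bernProb_mono h0 h1 ?_).trans ((bernProb_forall_false_le h0 h1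
      (aligned (fun x => !φ x) (star X (unfrozen F)ᶜ))).trans (Real.exp_le_exp.2 ?_))
    · intro b hXb C hC
      by_contra hb
      rw [Bool.not_eq_false] at hb
      obtain ⟨hv, hl⟩ := mem_aligned.1 hC
      obtain ⟨x, hx, u, hu, _, h⟩ := mem_star.1 hv
      refine mem_unfrozen.1 (hXb hx) (frozen_scan_of_mem_aligned hL hφ hb ?_ h.symm hl)
      intro y hy
      have := hu hy
      rwa [Finset.mem_compl, mem_unfrozen, not_not] at this
    · refine neg_le_neg (mul_le_mul_of_nonneg_left ?_ h0)
      exact_mod_cast card_le_card_aligned_star _ hX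
  -- Frozen variables stay frozen, so the event is empty if `X` contains one.
  · refine (bernProb_mono h0 h1 (B := fun _ => False) fun b hXb => hX ?_).trans ?_
    · rw [disjoint_compl_right_iff]
      exact hXb.trans (unfrozen_anti (subset_scan _ _))
    · simp only [bernProb, if_false, mul_zero, Finset.sum_const_zero]
      positivity

end SecondRound

/-! ### Variables that occur in many selected clauses. -/

section Counts

variable {n : ℕ}

/-- The clauses in `S` whose coin toss was successful. -/
def selected (b : Clause n → Bool) (S : Finset (Clause n)) : Finset (Clause n) :=
  S.filter fun C => b C = true

theorem card_selected (b : Clause n → Bool) (S : Finset (Clause n)) :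
    ((selected b S).card : ℝ) = ∑ C, if b C = true then (if C ∈ S then 1 else 0) else 0 := by
  rw [selected, Finset.card_filter]
  push_cast
  rw [← Finset.univ_inter S, ← Finset.sum_ite_mem]
  refine Finset.sum_congr rfl fun C _ => ?_
  by_cases h : C ∈ S <;> simp [h]

theorem sum_card_inter_clauseVars_le (X : Finset (Fin n)) :
    ∑ C : Clause n, ((X ∩ clauseVars C).card : ℝ) ≤ 8 * n ^ 2 * X.card := by
  have h : ∀ C : Clause n, ((X ∩ clauseVars C).card : ℝ)
      = ∑ x ∈ X, if C ∈ clausesAt x then (1 : ℝ) else 0 := by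
    intro C
    simp [mem_clausesAt]
  simp only [h]
  rw [Finset.sum_comm]
  refine (Finset.sum_le_card_nsmul _ _ (8 * (n : ℝ) ^ 2) fun x _ => ?_).trans_eq ?_
  · simp only [Finset.sum_ite_mem, Finset.univ_inter, Finset.sum_const, nsmul_eq_mul, mul_one]
    exact_mod_cast card_clausesAt_le x
  · rw [nsmul_eq_mul, mul_comm]

theorem card_inter_clauseVars_le (X : Finset (Fin n)) (C : Clause n) :
    ((X ∩ clauseVars C).card : ℝ) ≤ 3 := by
  have := (Finset.card_le_card (Finset.inter_subset_right (s₁ := X))).trans_eq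
    (card_clauseVars C)
  exact_mod_cast this

/-- The variables that appear in more than `r` selected clauses. -/
noncomputable def crowded (r : ℝ) (b : Clause n → Bool) : Finset (Fin n) :=
  Finset.univ.filter fun x => r < (selected b (clausesAt x)).card

/-- Chernoff for the sum of the degrees over `X`, where a clause counts with multiplicity at most 3.
The scale 1/4 keeps the exponents below 1, so that e^z - 1 ≤ 2z. -/
theorem bernProb_subset_crowded_le {q : ℝ} (h0 : 0 ≤ q) (h1 : q ≤ 1) (r : ℝ)
    (X : Finset (Fin n)) :
    bernProb q (fun b => X ⊆ crowded r b)
      ≤ Real.exp (-((r / 4 - 4 * (q * n ^ 2)) * X.card)) := by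
  refine (bernProb_mono h0 h1 ?_).trans ((bernProb_chernoff h0 h1
    (fun C : Clause n => ((X ∩ clauseVars C).card : ℝ) / 4) (r * X.card / 4)).trans
      (Real.exp_le_exp.2 ?_))
  · intro b hX
    have hsum : r * X.card ≤ ∑ x ∈ X, ((selected b (clausesAt x)).card : ℝ) := by
      rw [mul_comm, ← nsmul_eq_mul]
      exact Finset.card_nsmul_le_sum _ _ _ fun x hx => (Finset.mem_filter.1 (hX hx)).2.le
    have heq : ∑ x ∈ X, ((selected b (clausesAt x)).card : ℝ)
        = ∑ C, if b C = true then ((X ∩ clauseVars C).card : ℝ) else 0 := by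
      simp only [card_selected]
      rw [Finset.sum_comm]
      refine Finset.sum_congr rfl fun C _ => ?_
      by_cases hb : b C = true <;>
        simp [hb, mem_clausesAt]
    rw [heq] at hsum
    refine (div_le_div_of_nonneg_right hsum (by norm_num : (0 : ℝ) ≤ 4)).trans_eq ?_
    rw [Finset.sum_div]
    exact Finset.sum_congr rfl fun C _ => by split_ifs <;> simp
  · have hexp : ∑ C : Clause n, (Real.exp (((X ∩ clauseVars C).card : ℝ) / 4) - 1)
        ≤ ∑ C : Clause n, ((X ∩ clauseVars C).card : ℝ) / 2 := by
      refine Finset.sum_le_sum fun C _ => ?_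
      have h3 := card_inter_clauseVars_le X C
      have hnn : (0 : ℝ) ≤ ((X ∩ clauseVars C).card : ℝ) / 4 := by positivity
      have := Real.abs_exp_sub_one_le (x := ((X ∩ clauseVars C).card : ℝ) / 4)
        (by rw [abs_of_nonneg hnn]; linarith)
      rw [abs_of_nonneg hnn] at this
      linarith [le_abs_self (Real.exp (((X ∩ clauseVars C).card : ℝ) / 4) - 1)]
    rw [← Finset.sum_div] at hexp
    have := mul_le_mul_of_nonneg_left
      (hexp.trans (div_le_div_of_nonneg_right (sum_card_inter_clauseVars_le X) zero_le_two)) h0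
    linarith

end Counts

/-! ### Round three: the majority bias at frozen variables. -/

section ThirdRound

variable {n : ℕ}

/-- The clauses that contain the negation of the literal on `x` that is true under `φ`, except for
those that are false under `φ` and whose other variables belong to `Z`. -/
def opposing (φ : Assignment n) (Z : Finset (Fin n)) (x : Fin n) : Finset (Clause n) :=
  occurrences Finset.univ (x, !φ x) \ aligned (fun y => !φ y) (star {x} (Z.erase x))

/-- Both literals of `x` lie in equally many clauses; the deficit is the number of barred clauses,
at least one for each pair in `Z.erase x`. -/
theorem card_opposing_add_le (φ : Assignment n) (Z : Finset (Fin n)) (x : Fin n) :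
    (opposing φ Z x).card + (Z.card - 1).choose 2
      ≤ (occurrences Finset.univ (x, φ x)).card := by
  have hsub : aligned (fun y => !φ y) (star {x} (Z.erase x))
      ⊆ occurrences Finset.univ (x, !φ x) := by
    intro C hC
    obtain ⟨z, hz, u, _, _, h⟩ := mem_star.1 (mem_aligned.1 hC).1
    rw [Finset.mem_singleton] at hz
    subst hz
    exact Finset.mem_filter.2 ⟨Finset.mem_univ _,
      mem_of_mem_aligned hC (h ▸ Finset.mem_insert_self z u)⟩
  have h1 := card_le_card_aligned_star (fun y => !φ y) (X := {x}) (Y := Z.erase x) (by simp)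
  have h2 : (Z.card - 1).choose 2 ≤ (Z.erase x).card.choose 2 :=
    Nat.choose_le_choose 2 Finset.pred_card_le_card_erase
  rw [Finset.card_singleton, one_mul] at h1
  have h3 := Finset.card_sdiff_add_card_eq_card hsub
  rw [card_occurrences_univ_not] at h3
  rw [opposing]
  omega

/-- The variables for which the selected clauses that favour the value under `φ` exceed the opposing
ones by at most `ρ`. -/
noncomputable def contested (φ : Assignment n) (Z : Finset (Fin n)) (ρ : ℝ) (b : Clause n → Bool) :
    Finset (Fin n) :=
  Finset.univ.filter fun x => ((selected b (occurrences Finset.univ (x, φ x))).card : ℝ)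
    ≤ (selected b (opposing φ Z x)).card + ρ

/-- Chernoff for the signed count over `X`, at scale 1/200. With e^z - 1 ≤ z + z², the linear part
contributes -n²|X|/800 and the quadratic part at most (3/40000)·8n²|X|, leaving -(13/20000)n²|X|. -/
theorem bernProb_subset_contested_le {q : ℝ} (h0 : 0 ≤ q) (h1 : q ≤ 1) (φ : Assignment n)
    {Z : Finset (Fin n)} (hZ : (n : ℝ) ^ 2 / 4 ≤ ((Z.card - 1).choose 2 : ℕ)) (ρ : ℝ)
    (X : Finset (Fin n)) :
    bernProb q (fun b => X ⊆ contested φ Z ρ b)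
      ≤ Real.exp (-((13 / 20000 * (q * n ^ 2) - ρ / 200) * X.card)) := by
  classical
  let G : Fin n → Finset (Clause n) := fun x => occurrences Finset.univ (x, φ x)
  let v : Fin n → Clause n → ℝ := fun x C =>
    (if C ∈ opposing φ Z x then 1 else 0) - (if C ∈ G x then 1 else 0)
  have hv : ∀ x C, |v x C| ≤ if x ∈ clauseVars C then 1 else 0 := by
    intro x C
    by_cases hx : x ∈ clauseVars C
    · simp only [v, hx, if_true]
      split_ifs <;> simp
    · have hG : C ∉ G x := fun h => hx (mem_clauseVars_of_mem (Finset.mem_filter.1 h).2)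
      have hB : C ∉ opposing φ Z x := fun h =>
        hx (mem_clauseVars_of_mem (Finset.mem_filter.1 (Finset.mem_sdiff.1 h).1).2)
      simp [v, hG, hB, hx]
  have hsumv : ∀ C, |∑ x ∈ X, v x C| ≤ ((X ∩ clauseVars C).card : ℝ) := by
    intro C
    refine (Finset.abs_sum_le_sum_abs _ _).trans ((Finset.sum_le_sum fun x _ => hv x C).trans_eq ?_)
    simp
  refine (bernProb_mono h0 h1 ?_).trans ((bernProb_chernoff h0 h1
    (fun C : Clause n => (∑ x ∈ X, v x C) / 200) (-(ρ * X.card) / 200)).trans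
      (Real.exp_le_exp.2 ?_))
  · intro b hX
    have hsum : -(ρ * X.card) ≤ ∑ x ∈ X, (((selected b (opposing φ Z x)).card : ℝ)
        - (selected b (G x)).card) := by
      rw [mul_comm, ← mul_neg, ← nsmul_eq_mul]
      refine Finset.card_nsmul_le_sum _ _ _ fun x hx => ?_
      have := (Finset.mem_filter.1 (hX hx)).2
      simp only [G]
      linarith
    have heq : ∑ x ∈ X, (((selected b (opposing φ Z x)).card : ℝ) - (selected b (G x)).card)
        = ∑ C, if b C = true then ∑ x ∈ X, v x C else 0 := by
      simp only [card_selected, ← Finset.sum_sub_distrib]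
      rw [Finset.sum_comm]
      refine Finset.sum_congr rfl fun C _ => ?_
      by_cases hb : b C = true <;> simp [hb, v]
    rw [heq] at hsum
    refine (div_le_div_of_nonneg_right hsum (by norm_num : (0 : ℝ) ≤ 200)).trans_eq ?_
    rw [Finset.sum_div]
    exact Finset.sum_congr rfl fun C _ => by split_ifs <;> simp
  · have hexp : ∑ C : Clause n, (Real.exp ((∑ x ∈ X, v x C) / 200) - 1)
        ≤ ∑ C : Clause n, ((∑ x ∈ X, v x C) / 200
          + 3 / 40000 * ((X ∩ clauseVars C).card : ℝ)) := by
      refine Finset.sum_le_sum fun C _ => ?_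
      have h3 := card_inter_clauseVars_le X C
      have hs := hsumv C
      have hy := Real.abs_exp_sub_one_sub_id_le (x := (∑ x ∈ X, v x C) / 200) (by
        rw [abs_div, abs_of_pos (by norm_num : (0 : ℝ) < 200)]
        linarith)
      have hsq : (∑ x ∈ X, v x C) ^ 2 ≤ 3 * ((X ∩ clauseVars C).card : ℝ) := by
        rw [← sq_abs]
        nlinarith [abs_nonneg (∑ x ∈ X, v x C)]
      have := (le_abs_self _).trans hy
      rw [div_pow] at this
      linarith
    have hmean : ∑ C : Clause n, ∑ x ∈ X, v x C ≤ -(n ^ 2 / 4 * X.card) := by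
      rw [Finset.sum_comm, mul_comm, ← mul_neg, ← nsmul_eq_mul]
      refine Finset.sum_le_card_nsmul _ _ _ fun x _ => ?_
      have hc : (((opposing φ Z x).card + (Z.card - 1).choose 2 : ℕ) : ℝ) ≤ (G x).card := by
        exact_mod_cast card_opposing_add_le φ Z x
      push_cast at hc
      simp only [v, Finset.sum_sub_distrib, Finset.sum_ite_mem, Finset.univ_inter,
        Finset.sum_const, nsmul_eq_mul, mul_one]
      linarith
    rw [Finset.sum_add_distrib, ← Finset.sum_div, ← Finset.mul_sum] at hexp
    have hS := sum_card_inter_clauseVars_le X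
    have hfin : ∑ C : Clause n, (Real.exp ((∑ x ∈ X, v x C) / 200) - 1)
        ≤ -(13 / 20000 * n ^ 2 * X.card) := by linarith
    have := mul_le_mul_of_nonneg_left hfin h0
    linarith

/-- A frozen variable that is not contested in the third round and appears in few clauses of the
first two rounds is set correctly by the Majority Vote. -/
theorem maj_scan_eq {L : List (Clause n)} (hL : ∀ C, C ∈ L) {b₁ b₂ b₃ : Clause n → Bool}
    {F₂ : Formula n} (hF₂ : F₂ = scan (scan ∅ (L.filter b₁)) (L.filter b₂)) {φ ψ : Assignment n}
    (hφ : Satisfies φ F₂) (hψ : Satisfies ψ (scan F₂ (L.filter b₃))) {r : ℝ} {x : Fin n}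
    (hx : x ∉ unfrozen F₂) (h₁ : x ∉ crowded r b₁) (h₂ : x ∉ crowded r b₂)
    (h₃ : x ∉ contested φ (unfrozen F₂)ᶜ (2 * r) b₃) :
    maj (scan F₂ (L.filter b₃)) x = ψ x := by
  classical
  set F := scan F₂ (L.filter b₃) with hF
  have hagree : ∀ y ∉ unfrozen F₂, ψ y = φ y := fun y hy =>
    eq_of_notMem_unfrozen hy (hψ.mono (subset_scan _ _)) hφ
  simp only [crowded, contested, Finset.mem_filter, Finset.mem_univ, true_and, not_lt, not_le]
    at h₁ h₂ h₃
  have hgood : selected b₃ (occurrences Finset.univ (x, φ x)) ⊆ occurrences F (x, φ x) := by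
    intro C hC
    simp only [selected, occurrences, Finset.mem_filter, Finset.mem_univ, true_and] at hC ⊢
    exact ⟨mem_scan_of_satisfies (mem_filter_of_forall_mem hL hC.2) hψ
      ⟨_, hC.1, hagree x hx⟩, hC.1⟩
  have hbad : occurrences F (x, !φ x) ⊆ selected b₁ (clausesAt x) ∪ selected b₂ (clausesAt x)
      ∪ selected b₃ (opposing φ (unfrozen F₂)ᶜ x) := by
    intro C hC
    rw [occurrences, Finset.mem_filter] at hC
    obtain ⟨hCF, hxC⟩ := hC
    have hat : C ∈ clausesAt x := mem_clausesAt.2 (mem_clauseVars_of_mem hxC)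
    have hsub : b₁ C = true ∨ b₂ C = true ∨ b₃ C = true := by
      have h := scan_subset _ _ hCF
      rw [Finset.mem_union] at h
      rcases h with h | h
      · rw [hF₂] at h
        have h' := scan_subset _ _ h
        rw [Finset.mem_union] at h'
        rcases h' with h' | h'
        · have h'' := scan_subset _ _ h'
          simp only [Finset.empty_union, List.mem_toFinset, List.mem_filter] at h''
          exact Or.inl h''.2
        · simp only [List.mem_toFinset, List.mem_filter] at h'
          exact Or.inr (Or.inl h'.2)
      · simp only [List.mem_toFinset, List.mem_filter] at h
        exact Or.inr (Or.inr h.2)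
    simp only [Finset.mem_union, selected, Finset.mem_filter]
    rcases hsub with h | h | h
    · exact Or.inl (Or.inl ⟨hat, h⟩)
    · exact Or.inl (Or.inr ⟨hat, h⟩)
    · refine Or.inr ⟨Finset.mem_sdiff.2 ⟨Finset.mem_filter.2 ⟨Finset.mem_univ _, hxC⟩, ?_⟩, h⟩
      intro hal
      obtain ⟨hv, hl⟩ := mem_aligned.1 hal
      obtain ⟨z, hz, u, hu, _, hins⟩ := mem_star.1 hv
      obtain ⟨l, hlC, hψl⟩ := hψ C hCF
      have hmem := mem_clauseVars_of_mem hlC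
      rw [← hins, Finset.mem_insert] at hmem
      have hlZ : l.1 ∉ unfrozen F₂ := by
        rcases hmem with h | h
        · rw [h, Finset.mem_singleton.1 hz]
          exact hx
        · exact Finset.mem_compl.1 (Finset.mem_of_mem_erase (hu h))
      rw [hl l hlC, hagree _ hlZ] at hψl
      simp at hψl
  have hlt : (occurrences F (x, !φ x)).card < (occurrences F (x, φ x)).card := by
    have e1 : ((occurrences F (x, !φ x)).card : ℝ) ≤ (selected b₁ (clausesAt x)).card
        + (selected b₂ (clausesAt x)).card
        + (selected b₃ (opposing φ (unfrozen F₂)ᶜ x)).card := by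
      exact_mod_cast (Finset.card_le_card hbad).trans ((Finset.card_union_le _ _).trans
        (Nat.add_le_add_right (Finset.card_union_le _ _) _))
    have e2 : ((selected b₃ (occurrences Finset.univ (x, φ x))).card : ℝ)
        ≤ (occurrences F (x, φ x)).card := by
      exact_mod_cast Finset.card_le_card hgood
    have : ((occurrences F (x, !φ x)).card : ℝ) < (occurrences F (x, φ x)).card := by linarith
    exact_mod_cast this
  rw [hagree x hx, maj]
  -- The strict majority matters only for the value true; ties go to false.
  cases hφx : φ x
  · rw [hφx] at hlt
    simpa using hlt.le
  · rw [hφx] at hlt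
    simpa using hlt

end ThirdRound

/-! ### Numerical estimates and assembly of the three rounds. -/

theorem sq_div_four_le_choose_two {n m : ℕ} (hn : 300 ≤ n) (hm : 19 * n ≤ 20 * m + 20) :
    (n : ℝ) ^ 2 / 4 ≤ (m.choose 2 : ℕ) := by
  have h1 : (300 : ℝ) ≤ n := by exact_mod_cast hn
  have h2 : (19 : ℝ) * n ≤ 20 * m + 20 := by exact_mod_cast hm
  rw [Nat.cast_choose_two]
  have h3 : (3 / 4 : ℝ) * n ≤ m - 1 := by linarith
  nlinarith

theorem cube_div_le_choose_three {n : ℕ} (hn : 300 ≤ n) :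
    (n : ℝ) ^ 3 / 100000 ≤ ((n / 20).choose 3 : ℕ) := by
  set a := n / 20 with ha
  have h1 : (300 : ℝ) ≤ n := by exact_mod_cast hn
  have ha2 : 2 ≤ a := by omega
  have h2 : (n : ℝ) ≤ 20 * a + 19 := by
    have : n ≤ 20 * a + 19 := by omega
    exact_mod_cast this
  have h3 : (n : ℝ) / 25 ≤ ((a - 2 : ℕ) : ℝ) := by
    push_cast [Nat.cast_sub ha2]
    linarith
  have e1 : a.choose 3 * 3 = a.choose 2 * (a - 2) := Nat.choose_succ_right_eq a 2
  have e2 : (a.choose 3 : ℝ) * 3 = a * (a - 1) / 2 * ((a - 2 : ℕ) : ℝ) := by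
    rw [← Nat.cast_choose_two]
    exact_mod_cast e1
  have h4 : (n : ℝ) / 25 ≤ a - 1 := by linarith
  have h5 : (n : ℝ) / 25 ≤ a := by linarith
  have h0 : (0 : ℝ) ≤ n / 25 := by linarith
  have h6 : (n / 25 : ℝ) * (n / 25) * (n / 25) ≤ a * (a - 1) * ((a - 2 : ℕ) : ℝ) :=
    mul_le_mul (mul_le_mul h5 h4 h0 (by linarith)) h3 h0 (by nlinarith)
  have h7 : (0 : ℝ) ≤ (n : ℝ) ^ 3 := by positivity
  nlinarith

theorem choose_three_le {n : ℕ} :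
    (n / 20).choose 3 ≤ n / 20 * (n - 2 * (n / 20)).choose 2 := by
  set a := n / 20 with ha
  have e1 : a.choose 3 * 3 = a.choose 2 * (a - 2) := Nat.choose_succ_right_eq a 2
  have h1 : a.choose 2 * (a - 2) ≤ a.choose 2 * a := Nat.mul_le_mul_left _ (Nat.sub_le _ _)
  calc a.choose 3 ≤ a.choose 2 * a := by omega
    _ = a * a.choose 2 := mul_comm _ _
    _ ≤ a * (n - 2 * a).choose 2 :=
      Nat.mul_le_mul_left _ (Nat.choose_le_choose 2 (by omega))

theorem sum_bernWeight_mul_le_one {ι : Type*} [Fintype ι] [DecidableEq ι] {q : ℝ} (h0 : 0 ≤ q)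
    (h1 : q ≤ 1) {f : (ι → Bool) → ℝ} (hf : ∀ b, f b ≤ 1) :
    ∑ b, bernWeight q b * f b ≤ 1 := by
  rw [← sum_bernWeight (ι := ι) q]
  exact Finset.sum_le_sum fun b _ => mul_le_of_le_one_right (bernWeight_nonneg h0 h1 b) (hf b)

theorem first_round_bound {n : ℕ} (hn : 300 ≤ n) {p : ℝ} (hd : 4 * 10 ^ 9 ≤ (n : ℝ) ^ 2 * p) :
    2 * (4 ^ n * Real.exp (-(p / 10 ^ 4 * ((n / 20).choose 3 : ℕ))))
      ≤ 4 * 10 ^ 9 / (n * ((n : ℝ) ^ 2 * p)) := by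
  set lam := (n : ℝ) ^ 2 * p with hlam
  have hn0 : (300 : ℝ) ≤ n := by exact_mod_cast hn
  have hp : 0 < p := by
    by_contra! h
    nlinarith [sq_nonneg (n : ℝ)]
  have h1 : (n : ℝ) * lam / 10 ^ 9 ≤ p / 10 ^ 4 * ((n / 20).choose 3 : ℕ) := by
    calc (n : ℝ) * lam / 10 ^ 9 = p / 10 ^ 4 * ((n : ℝ) ^ 3 / 100000) := by rw [hlam]; ring
      _ ≤ _ := by gcongr; exact cube_div_le_choose_three hn
  have h4 : (4 : ℝ) ^ n ≤ Real.exp (2 * n) := by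
    have h : (4 : ℝ) ≤ Real.exp 2 := by
      have := Real.quadratic_le_exp_of_nonneg (x := 2) (by norm_num)
      linarith
    calc (4 : ℝ) ^ n ≤ Real.exp 2 ^ n := by gcongr
      _ = Real.exp (2 * n) := by rw [← Real.exp_nat_mul, mul_comm]
  set z := (n : ℝ) * lam / (2 * 10 ^ 9) with hz
  have hz0 : 0 < z := by positivity
  -- Half of the exponent 2z pays for 4ⁿ ≤ e^(2n); this is where λ ≥ 4·10⁹ is needed.
  have h2 : 2 * (n : ℝ) ≤ z := by
    rw [hz, le_div_iff₀ (by norm_num)]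
    nlinarith
  have h3 : Real.exp (-z) ≤ 1 / z := by
    rw [Real.exp_neg, ← one_div]
    exact one_div_le_one_div_of_le hz0 (by linarith [Real.add_one_le_exp z])
  calc _ ≤ 2 * (Real.exp (2 * n) * Real.exp (-((n : ℝ) * lam / 10 ^ 9))) := by gcongr
    _ = 2 * Real.exp (2 * n - 2 * z) := by
      rw [← Real.exp_add, hz]; congr 2; ring
    _ ≤ 2 * Real.exp (-z) := by gcongr; linarith
    _ ≤ 2 * (1 / z) := by gcongr
    _ = _ := by rw [hz]; field_simp; norm_num

theorem majClose_scan {n : ℕ} {L : List (Clause n)} (hL : ∀ C, C ∈ L) {b₁ b₂ b₃ : Clause n → Bool}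
    {F₂ : Formula n} (hF₂ : F₂ = scan (scan ∅ (L.filter b₁)) (L.filter b₂)) {φ : Assignment n}
    (hφ : Satisfies φ F₂) {r s : ℝ} (hu : ((unfrozen F₂).card : ℝ) ≤ s / 4)
    (h₁ : ((crowded r b₁).card : ℝ) ≤ s / 4) (h₂ : ((crowded r b₂).card : ℝ) ≤ s / 4)
    (h₃ : ((contested φ (unfrozen F₂)ᶜ (2 * r) b₃).card : ℝ) ≤ s / 4) :
    MajClose (scan F₂ (L.filter b₃)) s := by
  classical
  intro ψ hψ
  have hsub : (Finset.univ.filter fun x => ψ x ≠ maj (scan F₂ (L.filter b₃)) x)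
      ⊆ (unfrozen F₂ ∪ crowded r b₁) ∪
        (crowded r b₂ ∪ contested φ (unfrozen F₂)ᶜ (2 * r) b₃) := by
    intro x hx
    by_contra hcon
    simp only [Finset.mem_union, not_or] at hcon
    exact (Finset.mem_filter.1 hx).2
      (maj_scan_eq hL hF₂ hφ hψ hcon.1.1 hcon.1.2 hcon.2.1 hcon.2.2).symm
  have hcard : (hammingDist ψ (maj (scan F₂ (L.filter b₃))) : ℝ)
      ≤ ((unfrozen F₂).card + (crowded r b₁).card) +
        ((crowded r b₂).card + (contested φ (unfrozen F₂)ᶜ (2 * r) b₃).card) := by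
    exact_mod_cast (Finset.card_le_card hsub).trans ((Finset.card_union_le _ _).trans
      (add_le_add (Finset.card_union_le _ _) (Finset.card_union_le _ _)))
  linarith

theorem failure_probability_le {n : ℕ} (hn : 300 ≤ n) (p : unitInterval)
    (hd : 4 * 10 ^ 9 ≤ (n : ℝ) ^ 2 * (p : ℝ)) :
    ((Psat n p).toOuterMeasure {F | ¬ MajClose F
      (Real.exp (-(1 / 10 ^ 6 * ((n : ℝ) ^ 2 * (p : ℝ)))) * (n : ℝ))}).toReal
      ≤ 5 * 10 ^ 9 / (n * ((n : ℝ) ^ 2 * (p : ℝ))) := by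
  obtain ⟨p0, p1⟩ := p.2
  set lam := (n : ℝ) ^ 2 * (p : ℝ) with hlam
  set y : ℝ := 1 / 10 ^ 6 * lam with hy
  set q : ℝ := (p : ℝ) / 10 ^ 4 with hq
  set q₃ : ℝ := 1 - (1 - (p : ℝ)) / ((1 - q) * (1 - q)) with hq₃
  have hn0 : 0 < n := by omega
  have hnR : (300 : ℝ) ≤ n := by exact_mod_cast hn
  have q0 : 0 ≤ q := by positivity
  have q1 : q ≤ 1 := by rw [hq]; linarith
  have hden : 0 < (1 - q) * (1 - q) := by
    have : 0 < 1 - q := by rw [hq]; linarith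
    positivity
  have q31 : q₃ ≤ 1 := by
    have : 0 ≤ (1 - (p : ℝ)) / ((1 - q) * (1 - q)) := div_nonneg (by linarith) hden.le
    linarith
  have q3p : (p : ℝ) / 2 ≤ q₃ := by
    have : (1 - (p : ℝ)) / ((1 - q) * (1 - q)) ≤ 1 - p / 2 := by
      rw [div_le_iff₀ hden, hq]
      nlinarith [mul_nonneg p0 p0, mul_nonneg p0 (sub_nonneg.2 p1)]
    linarith
  have q30 : 0 ≤ q₃ := by linarith
  have hqq : 1 - (p : ℝ) = (1 - q) * ((1 - q) * (1 - q₃)) := by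
    have e : 1 - q₃ = (1 - (p : ℝ)) / ((1 - q) * (1 - q)) := by rw [hq₃]; ring
    rw [e, ← mul_assoc, mul_div_cancel₀ _ hden.ne']
  have hlam0 : 0 < lam := by linarith
  have hy3 : 3 ≤ y := by rw [hy]; linarith
  have hnn : (n : ℝ) ^ 2 * q = lam / 10 ^ 4 := by rw [hlam, hq]; ring
  have hn3 : lam / 2 ≤ n ^ 2 * q₃ := by
    have := mul_le_mul_of_nonneg_left q3p (sq_nonneg (n : ℝ))
    linarith
  set s : ℝ := Real.exp (-y) * n with hs
  set a := n / 20 with ha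
  -- All rates must reach 4y = 4λ/10⁶. Crowding gives r/4 - 4n²q = 21λ/10⁴, round two gives qn²/4 =
  -- λ/(4·10⁴), and round three, with ρ = 2r and n²q₃ ≥ λ/2, gives at least 13λ/40000 - λ/10⁴.
  set r := lam / 100 with hr
  have hcrowded : bernProb q (fun b : Clause n → Bool => s / 4 < (crowded r b).card)
      ≤ 4 / (n * y) := by
    refine bernProb_many_fail_le q0 q1 hn0 hy3 _ fun X => ?_
    refine (bernProb_subset_crowded_le q0 q1 r X).trans (Real.exp_le_exp.2 (neg_le_neg ?_))
    refine mul_le_mul_of_nonneg_right ?_ (Nat.cast_nonneg _)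
    rw [hr, hy]
    linarith
  -- The summands are, in order: unfrozen and crowded variables in round one, the same in round two,
  -- contested variables in round three.
  refine (toReal_Psat_le p hqq _ (δ := (4 * 10 ^ 9 / (n * lam) + 4 / (n * y))
    + ((4 / (n * y) + 4 / (n * y)) + 4 / (n * y))) fun σ => ?_).trans ?_
  swap
  · have e : 4 / (n * y) = 4 * 10 ^ 6 / (n * lam) := by rw [hy]; field_simp
    rw [e, ← add_div, ← add_div, ← add_div, ← add_div]
    exact div_le_div_of_nonneg_right (by norm_num) (by positivity)
  set L := List.ofFn σ with hLdef
  have hL : ∀ C, C ∈ L := fun C => by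
    rw [hLdef, List.mem_ofFn]
    exact σ.surjective C
  have hpos : 0 ≤ 4 / (n * y) := by positivity
  refine (sum_bernWeight_mul_le q0 q1 (A := fun b₁ =>
    a ≤ (unfrozen (scan ∅ (L.filter b₁))).card ∨ s / 4 < (crowded r b₁).card)
    (δ := (4 / (n * y) + 4 / (n * y)) + 4 / (n * y)) (by positivity)
    (fun b₁ => sum_bernWeight_mul_le_one q0 q1 fun b₂ => bernProb_le_one q30 q31 _) ?_).trans ?_
  swap
  · refine add_le_add_left ((bernProb_or_le q0 q1 _ _).trans (add_le_add ?_ hcrowded)) _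
    exact (bernProb_card_unfrozen_le hL q0 q1 le_rfl choose_three_le).trans
      (first_round_bound hn hd)
  intro b₁ hb₁
  rw [not_or, not_le, not_lt] at hb₁
  set F₁ := scan ∅ (L.filter b₁) with hF₁
  have hsat₁ : Satisfiable F₁ := satisfiable_scan satisfiable_empty _
  have hcompl : (unfrozen F₁)ᶜ.card = n - (unfrozen F₁).card := by
    rw [Finset.card_compl, Fintype.card_fin]
  refine (sum_bernWeight_mul_le q0 q1 (A := fun b₂ =>
    s / 4 < (unfrozen (scan F₁ (L.filter b₂))).card ∨ s / 4 < (crowded r b₂).card)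
    (δ := 4 / (n * y)) hpos (fun b₂ => bernProb_le_one q30 q31 _) ?_).trans ?_
  swap
  · refine add_le_add_left ((bernProb_or_le q0 q1 _ _).trans (add_le_add ?_ hcrowded)) _
    refine bernProb_many_fail_le q0 q1 hn0 hy3 _ fun X => ?_
    refine (bernProb_subset_unfrozen_le hL q0 q1 hsat₁ X).trans
      (Real.exp_le_exp.2 (neg_le_neg ?_))
    have hch : (n : ℝ) ^ 2 / 4 ≤ ((unfrozen F₁)ᶜ.card.choose 2 : ℕ) :=
      sq_div_four_le_choose_two hn (by omega)
    calc 4 * y * X.card ≤ q * (n ^ 2 / 4) * X.card := by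
          refine mul_le_mul_of_nonneg_right ?_ (Nat.cast_nonneg _)
          rw [hy]
          linarith
      _ ≤ q * ((unfrozen F₁)ᶜ.card.choose 2 : ℕ) * X.card :=
          mul_le_mul_of_nonneg_right (mul_le_mul_of_nonneg_left hch q0) (Nat.cast_nonneg _)
      _ = _ := by ring
  intro b₂ hb₂
  rw [not_or, not_lt, not_lt] at hb₂
  set F₂ := scan F₁ (L.filter b₂) with hF₂
  obtain ⟨φ, hφ⟩ : Satisfiable F₂ := satisfiable_scan hsat₁ _
  have hcompl₂ : (unfrozen F₂)ᶜ.card = n - (unfrozen F₂).card := by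
    rw [Finset.card_compl, Fintype.card_fin]
  have hle : (unfrozen F₂).card ≤ (unfrozen F₁).card :=
    Finset.card_le_card (unfrozen_anti (subset_scan _ _))
  refine (bernProb_mono q30 q31 (B := fun b₃ =>
    s / 4 < (contested φ (unfrozen F₂)ᶜ (2 * r) b₃).card) fun b₃ hb₃ => ?_).trans ?_
  · by_contra! hcon
    exact hb₃ (majClose_scan hL hF₂ hφ hb₂.1 hb₁.2 hb₂.2 hcon)
  · refine bernProb_many_fail_le q30 q31 hn0 hy3 _ fun X => ?_
    refine (bernProb_subset_contested_le q30 q31 φ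
      (sq_div_four_le_choose_two hn (by omega)) (2 * r) X).trans
      (Real.exp_le_exp.2 (neg_le_neg ?_))
    refine mul_le_mul_of_nonneg_right ?_ (Nat.cast_nonneg _)
    rw [hr, hy]
    linarith

theorem expectedTosses_le {n : ℕ} (p : unitInterval) :
    expectedTosses n p ≤ 2 * (n * ((n : ℝ) ^ 2 * (p : ℝ))) := by
  have h := Nat.choose_le_pow_div (α := ℝ) 3 n
  have h6 : ((Nat.factorial 3 : ℕ) : ℝ) = 6 := by norm_num [Nat.factorial]
  rw [h6] at h
  have hp := p.2.1
  rw [expectedTosses]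
  push_cast
  have := mul_le_mul_of_nonneg_left h hp
  have h3 : 0 ≤ (p : ℝ) * (n : ℝ) ^ 3 := by positivity
  linarith

theorem expectedTosses_pos {n : ℕ} (hn : 3 ≤ n) {p : unitInterval} (hp : 0 < (p : ℝ)) :
    0 < expectedTosses n p := by
  rw [expectedTosses]
  have := Nat.choose_pos hn
  positivity

end RandomSat

theorem mainTheorem4 :
    ∃ c : ℝ, 0 < c ∧ ∃ d : ℝ, 0 < d ∧
      ∀ p : ℕ → unitInterval,
        (∀ᶠ n : ℕ in Filter.atTop, d ≤ (n : ℝ) ^ 2 * (p n : ℝ)) →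
        RandomSat.Whp p fun n F =>
          RandomSat.MajClose F (Real.exp (-(c * ((n : ℝ) ^ 2 * (p n : ℝ)))) * (n : ℝ)) := by
  refine ⟨1 / 10 ^ 6, by norm_num, 4 * 10 ^ 9, by norm_num, fun p hp => ?_⟩
  rw [RandomSat.Whp, Asymptotics.isLittleO_iff]
  intro ε hε
  -- With u = nλ ≥ 2n this makes (5·10⁹/ε)²·2u ≤ u², which turns the bound 5·10⁹/u into ε·m^(-1/2),
  -- as m ≤ 2u.
  have hbig : ∀ᶠ n : ℕ in Filter.atTop, (5 * 10 ^ 9 / ε) ^ 2 ≤ (n : ℝ) :=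
    tendsto_natCast_atTop_atTop.eventually_ge_atTop _
  filter_upwards [hp, hbig, Filter.eventually_ge_atTop 300] with n hd hN hn
  have hnR : (300 : ℝ) ≤ n := by exact_mod_cast hn
  have hp0 : 0 < (p n : ℝ) := by
    by_contra! h
    nlinarith [sq_nonneg (n : ℝ)]
  have hm := RandomSat.expectedTosses_pos (by omega : 3 ≤ n) hp0
  have hm2 := RandomSat.expectedTosses_le (n := n) (p n)
  have hfail := RandomSat.failure_probability_le hn (p n) hd
  rw [Real.norm_of_nonneg ENNReal.toReal_nonneg, Real.norm_of_nonneg (by positivity)]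
  refine hfail.trans ?_
  set u := (n : ℝ) * ((n : ℝ) ^ 2 * (p n : ℝ)) with hu
  set m := RandomSat.expectedTosses n (p n)
  have hnu : 2 * (n : ℝ) ≤ u := by nlinarith
  have hu0 : 0 < u := by linarith
  have hsqrt : Real.sqrt m ≤ Real.sqrt (2 * u) := Real.sqrt_le_sqrt hm2
  have hkey : 5 * 10 ^ 9 / ε * Real.sqrt (2 * u) ≤ u := by
    rw [← Real.sqrt_sq (by positivity : (0 : ℝ) ≤ 5 * 10 ^ 9 / ε),
      ← Real.sqrt_mul (by positivity)]
    refine Real.sqrt_le_iff.2 ⟨hu0.le, ?_⟩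
    nlinarith
  have hsm : 0 < Real.sqrt m := Real.sqrt_pos.2 hm
  rw [← div_eq_mul_inv, div_le_div_iff₀ hu0 hsm]
  calc 5 * 10 ^ 9 * Real.sqrt m ≤ 5 * 10 ^ 9 * Real.sqrt (2 * u) := by gcongr
    _ = ε * (5 * 10 ^ 9 / ε * Real.sqrt (2 * u)) := by field_simp
    _ ≤ ε * u := by gcongr
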